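/- Let $(M^m,g)$ be a smooth Riemannian manifold, let $n\ge 1$, and let $\varphi=(\varphi^1,\dots,\varphi^n):M\to\mathbb R^n$ be a smooth map. Let $\Delta=\operatorname{trace}_g\nabla d$ denote the Laplace–Beltrami operator of $(M,g)$ (applied componentwise to maps into $\mathbb R^n$ or $\mathbb C=\mathbb R^2$), and also the usual Laplacian of $\mathbb R^n$. A function or a map $u$ into a Euclidean space, defined on an open subset of $M$, is called *biharmonic* if it is smooth and $\Delta^2u=0$. The map $\varphi$ is called *horizontally weakly conformal* if for every $x\in M$ either $d\varphi_x=0$, or $d\varphi_x$ is surjective and there is $\lambda(x)>0$ with $\langle d\varphi_x(X),d\varphi_x(Y)\rangle=\lambda(x)^2g(X,Y)$ for all $X,Y\in(\ker d\varphi_x)^\perp$. Then the following statements are equivalent: (i) $\varphi$ is a generalized harmonic morphism: for every open $U\subseteq\mathbb R^n$ with $\varphi^{-1}(U)\neq\emptyset$ and every smooth harmonic function $f:U\to\mathbb R$, the function $f\circ\varphi$ is biharmonic on $\varphi^{-1}(U)$; (ii) $\varphi$ is a horizontally weakly conformal biharmonic map, and $(\varphi^\alpha+i\varphi^\beta)^2:M\to\mathbb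 C$ is biharmonic for all $\alpha\neq\beta$ in $\{1,\dots,n\}$; (iii) there is a function $\lambda:M\to[0,\infty)$ with $\lambda^2$ smooth such that, for every open $U\subseteq\mathbb R^n$ and every smooth $f:U\to\mathbb R$, on $\varphi^{-1}(U)$, $$\Delta^2(f\circ\varphi)=\lambda^4(\Delta^2f)\circ\varphi+2\sum_{\alpha=1}^n\bigl[\lambda^2\Delta\varphi^\alpha+g(\nabla\lambda^2,\nabla\varphi^\alpha)\bigr](\partial_\alpha\Delta f)\circ\varphi+\bigl[\Delta\lambda^2+2g(\nabla\varphi^1,\nabla\Delta\varphi^1)+(\Delta\varphi^1)^2\bigr](\Delta f)\circ\varphi .$$ -/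

import Mathlib

open scoped Manifold ContDiff Laplacian InnerProductSpace

noncomputable section

namespace GenHarm

/-- A smooth Riemannian metric on an `m`-dimensional manifold `M`. -/
abbrev RMetric (m : ℕ) (M : Type*) [TopologicalSpace M]
    [ChartedSpace (EuclideanSpace ℝ (Fin m)) M] [IsManifold (𝓡 m) ∞ M] :=
  Bundle.ContMDiffRiemannianMetric (𝓡 m) ∞ (EuclideanSpace ℝ (Fin m))
    (fun x : M => TangentSpace (𝓡 m) x)

/-- The `i`-th partial derivative of a function on `ℝᵏ`. -/
def pderiv {k : ℕ} {F : Type*} [NormedAddCommGroup F] [NormedSpace ℝ F] (i : Fin k)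
    (f : EuclideanSpace ℝ (Fin k) → F) (y : EuclideanSpace ℝ (Fin k)) : F :=
  fderiv ℝ f y (EuclideanSpace.single i 1)

section Geometry

variable {m : ℕ} {M : Type*} [TopologicalSpace M]
  [ChartedSpace (EuclideanSpace ℝ (Fin m)) M] [IsManifold (𝓡 m) ∞ M]

/-- `g` at `x`, as a bilinear form on the tangent space. -/
def RMetric.form (g : RMetric m M) (x : M) : LinearMap.BilinForm ℝ (TangentSpace (𝓡 m) x) :=
  LinearMap.mk₂ ℝ (fun v w => g.inner x v w) (by simp) (by simp) (by simp) (by simp)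

theorem RMetric.form_nondegenerate (g : RMetric m M) (x : M) : (g.form x).Nondegenerate := by
  refine ⟨fun v hv => ?_, fun v hv => ?_⟩ <;>
  · by_contra h
    exact (g.pos x v h).ne' (hv v)

instance finiteDimensional_tangentSpace (x : M) :
    FiniteDimensional ℝ (TangentSpace (𝓡 m) x) :=
  inferInstanceAs (FiniteDimensional ℝ (EuclideanSpace ℝ (Fin m)))

variable {F : Type*} [NormedAddCommGroup F] [NormedSpace ℝ F]

/-- The differential of a vector-valued map. -/
def dmap (φ : M → F) (x : M) : TangentSpace (𝓡 m) x →L[ℝ] F :=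
  mfderiv (𝓡 m) 𝓘(ℝ, F) φ x

/-- The gradient `∇u` of a real function `u`: the vector field dual to `du`. -/
def grad (g : RMetric m M) (u : M → ℝ) (x : M) : TangentSpace (𝓡 m) x :=
  (LinearMap.BilinForm.toDual (g.form x) (g.form_nondegenerate x)).symm (dmap u x).toLinearMap

/-- The defining property of the gradient: `g(∇u, v) = du(v)`. -/
theorem inner_grad (g : RMetric m M) (u : M → ℝ) (x : M) (v : TangentSpace (𝓡 m) x) :
    g.inner x (grad g u x) v = dmap u x v :=
  LinearMap.BilinForm.apply_toDual_symm_apply (hB := g.form_nondegenerate x)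
    (dmap u x).toLinearMap v

/-- `g(∇u, ∇v)`. -/
def gradInner (g : RMetric m M) (u v : M → ℝ) (x : M) : ℝ :=
  g.inner x (grad g u x) (grad g v x)

/-- The coordinate vector field `∂ᵢ` of the chart around `x`, at the point with coordinates `y`. -/
def coordVec (x : M) (i : Fin m) (y : EuclideanSpace ℝ (Fin m)) :
    TangentSpace (𝓡 m) ((chartAt (EuclideanSpace ℝ (Fin m)) x).symm y) :=
  mfderiv (𝓡 m) (𝓡 m) (chartAt (EuclideanSpace ℝ (Fin m)) x).symm y
    (EuclideanSpace.single i 1 : EuclideanSpace ℝ (Fin m))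

/-- The matrix `g_{ij}` of the metric in the chart around `x`, as a function of the coordinates. -/
def gram (g : RMetric m M) (x : M) (y : EuclideanSpace ℝ (Fin m)) : Matrix (Fin m) (Fin m) ℝ :=
  Matrix.of fun i j => g.inner _ (coordVec x i y) (coordVec x j y)

/-- The Christoffel symbol `Γᵏᵢⱼ` of the Levi-Civita connection in the chart around `x`. -/
def christoffel (g : RMetric m M) (x : M) (k i j : Fin m) (y : EuclideanSpace ℝ (Fin m)) : ℝ :=
  (1 / 2) * ∑ l, (gram g x y)⁻¹ k l *
    (pderiv i (fun z => gram g x z j l) y + pderiv j (fun z => gram g x z i l) y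
      - pderiv l (fun z => gram g x z i j) y)

/-- The Laplace-Beltrami operator
`Δu = trace_g ∇du = gⁱʲ (∂ᵢ∂ⱼu - Γᵏᵢⱼ ∂ₖu)`
on functions with values in a vector space, evaluated at `x` in the chart around `x`.
For a map `u` into a Euclidean space, `Δu` is the tension field of `u`. -/
def lap (g : RMetric m M) (u : M → F) (x : M) : F :=
  let e := chartAt (EuclideanSpace ℝ (Fin m)) x
  let w : EuclideanSpace ℝ (Fin m) → F := u ∘ e.symm
  ∑ i, ∑ j, (gram g x (e x))⁻¹ i j •
    (pderiv i (pderiv j w) (e x) - ∑ k, christoffel g x k i j (e x) • pderiv k w (e x))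

/-- `u` is biharmonic on the open set `V`: it is smooth there and `Δ²u = 0`.
For `F` a Euclidean space (such as `ℝ`, `ℂ`, `ℝⁿ`), these are the biharmonic maps `V → F`,
the bitension field of a map into a flat target being `Δ²u` up to sign. -/
def BiharmonicOn (g : RMetric m M) (u : M → F) (V : Set M) : Prop :=
  ContMDiffOn (𝓡 m) 𝓘(ℝ, F) ∞ u V ∧ ∀ x ∈ V, lap g (lap g u) x = 0

/-- A biharmonic map `u : M → F` into a Euclidean space. -/
def Biharmonic (g : RMetric m M) (u : M → F) : Prop :=
  BiharmonicOn g u Set.univ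

variable {n : ℕ}

/-- `φ` is a generalized harmonic morphism: it pulls back (smooth) harmonic functions on open
subsets of `ℝⁿ` to biharmonic functions. -/
def GeneralizedHarmonicMorphism (g : RMetric m M) (φ : M → EuclideanSpace ℝ (Fin n)) : Prop :=
  ∀ (U : Set (EuclideanSpace ℝ (Fin n))) (f : EuclideanSpace ℝ (Fin n) → ℝ),
    IsOpen U → (φ ⁻¹' U).Nonempty → ContDiffOn ℝ ∞ f U →
      InnerProductSpace.HarmonicOnNhd f U → BiharmonicOn g (f ∘ φ) (φ ⁻¹' U)

/-- `X` is horizontal: orthogonal to the kernel of `dφₓ`. -/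
def Horizontal (g : RMetric m M) (φ : M → F) (x : M) (X : TangentSpace (𝓡 m) x) : Prop :=
  ∀ V : TangentSpace (𝓡 m) x, dmap φ x V = 0 → g.inner x X V = 0

/-- Horizontal weak conformality: at each point, either `dφₓ = 0`, or `dφₓ` maps the
horizontal space conformally onto the tangent space of the target. -/
def HorizontallyWeaklyConformal (g : RMetric m M) (φ : M → EuclideanSpace ℝ (Fin n)) : Prop :=
  ∀ x, dmap (m := m) φ x = 0 ∨
    (Function.Surjective (dmap (m := m) φ x) ∧
      ∃ lam : ℝ, 0 < lam ∧ ∀ X Y : TangentSpace (𝓡 m) x,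
        Horizontal g φ x X → Horizontal g φ x Y →
          ⟪dmap φ x X, dmap φ x Y⟫_ℝ = lam ^ 2 * g.inner x X Y)

end Geometry

end GenHarm

end

noncomputable section

namespace GenHarm

section Euclidean

variable {m : ℕ} {F : Type*} [NormedAddCommGroup F] [NormedSpace ℝ F]

/-- The standard basis vector of `ℝᵏ`. -/
abbrev stdVec {k : ℕ} (i : Fin k) : EuclideanSpace ℝ (Fin k) := EuclideanSpace.single i 1

/-- The Christoffel symbols of a matrix-valued function on `ℝᵐ`. -/
def coordChristoffel (G : EuclideanSpace ℝ (Fin m) → Matrix (Fin m) (Fin m) ℝ)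
    (k i j : Fin m) (y : EuclideanSpace ℝ (Fin m)) : ℝ :=
  (1 / 2) * ∑ l, (G y)⁻¹ k l *
    (pderiv i (fun z => G z j l) y + pderiv j (fun z => G z i l) y
      - pderiv l (fun z => G z i j) y)

/-- The Laplace operator of a matrix-valued function on `ℝᵐ`. -/
def coordLap (G : EuclideanSpace ℝ (Fin m) → Matrix (Fin m) (Fin m) ℝ)
    (w : EuclideanSpace ℝ (Fin m) → F) (y : EuclideanSpace ℝ (Fin m)) : F :=
  ∑ i, ∑ j, (G y)⁻¹ i j •
    (pderiv i (pderiv j w) y - ∑ k, coordChristoffel G k i j y • pderiv k w y)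

/-- The Gram matrix of a field of bilinear forms in the standard basis. -/
def gramMat (B : EuclideanSpace ℝ (Fin m) → EuclideanSpace ℝ (Fin m) →L[ℝ]
    EuclideanSpace ℝ (Fin m) →L[ℝ] ℝ) (y : EuclideanSpace ℝ (Fin m)) :
    Matrix (Fin m) (Fin m) ℝ :=
  Matrix.of fun i j => B y (stdVec i) (stdVec j)

theorem eq_sum_stdVec (v : EuclideanSpace ℝ (Fin m)) : v = ∑ i, v i • stdVec i := by
  have := (EuclideanSpace.basisFun (Fin m) ℝ).sum_repr v
  simpa using this.symm

theorem fderiv_comp_dir {E₁ E₂ E₃ : Type*} [NormedAddCommGroup E₁] [NormedSpace ℝ E₁]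
    [NormedAddCommGroup E₂] [NormedSpace ℝ E₂] [NormedAddCommGroup E₃] [NormedSpace ℝ E₃]
    {f : E₂ → E₃} {h : E₁ → E₂} {x : E₁} (hf : DifferentiableAt ℝ f (h x))
    (hh : DifferentiableAt ℝ h x) : DifferentiableAt ℝ (fun z => f (h z)) x ∧
      ∀ v, fderiv ℝ (fun z => f (h z)) x v = fderiv ℝ f (h x) (fderiv ℝ h x v) :=
  ⟨hf.comp x hh, fun v => by rw [fderiv_fun_comp x hf hh]; rfl⟩

theorem fderiv_fderiv_comp {E₁ E₂ E₃ : Type*} [NormedAddCommGroup E₁] [NormedSpace ℝ E₁]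
    [NormedAddCommGroup E₂] [NormedSpace ℝ E₂] [NormedAddCommGroup E₃] [NormedSpace ℝ E₃]
    {f : E₂ → E₃} {h : E₁ → E₂} {x : E₁} (hf : ContDiffAt ℝ 2 f (h x))
    (hh : ContDiffAt ℝ 2 h x) (v u : E₁) : fderiv ℝ (fderiv ℝ (f ∘ h)) x v u =
      fderiv ℝ (fderiv ℝ f) (h x) (fderiv ℝ h x v) (fderiv ℝ h x u)
        + fderiv ℝ f (h x) (fderiv ℝ (fderiv ℝ h) x v u) := by
  have dh : DifferentiableAt ℝ h x := hh.differentiableAt (by norm_num)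
  have ddh : DifferentiableAt ℝ (fderiv ℝ h) x :=
    (hh.fderiv_right (m := 1) (by norm_num)).differentiableAt (by norm_num)
  have ddf : DifferentiableAt ℝ (fderiv ℝ f) (h x) :=
    (hf.fderiv_right (m := 1) (by norm_num)).differentiableAt (by norm_num)
  have e : fderiv ℝ (f ∘ h) =ᶠ[nhds x] fun z => (fderiv ℝ f (h z)).comp (fderiv ℝ h z) := by
    filter_upwards [hh.eventually (by simp), (dh.continuousAt).eventually
      (hf.eventually (by simp))] with z hz hz'
    exact fderiv_comp z (hz'.differentiableAt (by norm_num)) (hz.differentiableAt (by norm_num))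
  rw [e.fderiv_eq, fderiv_clm_comp (fderiv_comp_dir ddf dh).1 ddh]
  simp [(fderiv_comp_dir ddf dh).2 v]
  abel

theorem pderiv_pderiv {w : EuclideanSpace ℝ (Fin m) → F} {y : EuclideanSpace ℝ (Fin m)}
    (hw : ContDiffAt ℝ 2 w y) (i j : Fin m) :
    pderiv i (pderiv j w) y = fderiv ℝ (fderiv ℝ w) y (stdVec i) (stdVec j) := by
  have h : DifferentiableAt ℝ (fderiv ℝ w) y :=
    (hw.fderiv_right (m := 1) (by norm_num)).differentiableAt (by norm_num)
  change fderiv ℝ (fun z => fderiv ℝ w z (stdVec j)) y (stdVec i) = _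
  rw [fderiv_clm_apply h (by fun_prop)]
  simp

theorem bilin_eq_sum_stdVec (b : EuclideanSpace ℝ (Fin m) →L[ℝ] EuclideanSpace ℝ (Fin m) →L[ℝ] ℝ)
    (v w : EuclideanSpace ℝ (Fin m)) :
    b v w = ∑ i, ∑ j, v i * w j * b (stdVec i) (stdVec j) := by
  conv_lhs => rw [eq_sum_stdVec v, eq_sum_stdVec w]
  simp only [map_sum, map_smul, sum_apply, smul_apply, smul_eq_mul, Finset.mul_sum]
  rw [Finset.sum_comm]
  exact Finset.sum_congr rfl fun i _ => Finset.sum_congr rfl fun j _ => by ring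

/-- A nondegenerate bilinear form on `ℝᵐ` has an invertible Gram matrix. -/
theorem isUnit_det_gramMat {B : EuclideanSpace ℝ (Fin m) → EuclideanSpace ℝ (Fin m) →L[ℝ]
    EuclideanSpace ℝ (Fin m) →L[ℝ] ℝ} {y : EuclideanSpace ℝ (Fin m)}
    (hn : ∀ v, (∀ w, B y w v = 0) → v = 0) : IsUnit (gramMat B y).det := by
  rw [isUnit_iff_ne_zero]
  intro h0
  obtain ⟨c, hc, hc0⟩ := Matrix.exists_mulVec_eq_zero_iff.2 h0
  apply hc
  have : (WithLp.toLp 2 c : EuclideanSpace ℝ (Fin m)) = 0 := by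
    apply hn
    intro w
    rw [bilin_eq_sum_stdVec]
    apply Finset.sum_eq_zero
    intro i _
    have := congrFun hc0 i
    simp only [Matrix.mulVec, dotProduct, gramMat, Matrix.of_apply, Pi.zero_apply] at this
    simp only [mul_assoc, ← Finset.mul_sum]
    rw [mul_eq_zero]
    right
    rw [← this]
    exact Finset.sum_congr rfl fun j _ => mul_comm _ _
  ext i
  simpa using congrArg (fun v : EuclideanSpace ℝ (Fin m) => v i) this

/-- The first-kind Christoffel form of a field of bilinear forms. -/
def christoffelForm (D : EuclideanSpace ℝ (Fin m) →L[ℝ] EuclideanSpace ℝ (Fin m) →L[ℝ]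
    EuclideanSpace ℝ (Fin m) →L[ℝ] ℝ) (v w z : EuclideanSpace ℝ (Fin m)) : ℝ :=
  (1 / 2) * (D v w z + D w v z - D z v w)

/-- The Christoffel symbols of a field of nondegenerate symmetric forms, as a bilinear map. -/
theorem exists_christoffelMap {B : EuclideanSpace ℝ (Fin m) → EuclideanSpace ℝ (Fin m) →L[ℝ]
    EuclideanSpace ℝ (Fin m) →L[ℝ] ℝ} {y : EuclideanSpace ℝ (Fin m)}
    (hd : DifferentiableAt ℝ B y) (hs : ∀ v w, B y v w = B y w v)
    (hn : ∀ v, (∀ w, B y v w = 0) → v = 0) :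
    ∃ C : EuclideanSpace ℝ (Fin m) →ₗ[ℝ] EuclideanSpace ℝ (Fin m) →ₗ[ℝ]
        EuclideanSpace ℝ (Fin m),
      (∀ v w z, B y (C v w) z = christoffelForm (fderiv ℝ B y) v w z) ∧
      ∀ i j, C (stdVec i) (stdVec j) = ∑ k, coordChristoffel (gramMat B) k i j y • stdVec k := by
  let b : LinearMap.BilinForm ℝ (EuclideanSpace ℝ (Fin m)) := (B y).toLinearMap₁₂
  have hb : b.Nondegenerate :=
    ⟨fun v hv => hn v hv, fun v hv => hn v fun w => (hs v w).trans (hv w)⟩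
  let S : EuclideanSpace ℝ (Fin m) →ₗ[ℝ] EuclideanSpace ℝ (Fin m) →ₗ[ℝ]
      Module.Dual ℝ (EuclideanSpace ℝ (Fin m)) :=
    LinearMap.mk₂ ℝ (fun v w =>
      { toFun := christoffelForm (fderiv ℝ B y) v w
        map_add' := by intros; simp [christoffelForm]; ring
        map_smul' := by intros; simp [christoffelForm]; ring })
      (by intros; ext; simp [christoffelForm]; ring) (by intros; ext; simp [christoffelForm]; ring)
      (by intros; ext; simp [christoffelForm]; ring) (by intros; ext; simp [christoffelForm]; ring)
  have hC : ∀ v w z, B y ((LinearMap.BilinForm.toDual b hb).symm (S v w)) z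
      = christoffelForm (fderiv ℝ B y) v w z := fun v w z =>
    LinearMap.BilinForm.apply_toDual_symm_apply (hB := hb) (S v w) z
  have hdet : IsUnit (gramMat B y).det :=
    isUnit_det_gramMat fun v hv => hn v fun w => (hs v w).trans (hv w)
  have hG : ∀ i j l : Fin m, pderiv i (fun z => gramMat B z j l) y
      = fderiv ℝ B y (stdVec i) (stdVec j) (stdVec l) := by
    intro i j l
    change fderiv ℝ (fun z => B z (stdVec j) (stdVec l)) y (stdVec i) = _
    rw [fderiv_clm_apply (by fun_prop) (by fun_prop), fderiv_clm_apply hd (by fun_prop)]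
    simp
  refine ⟨S.compr₂ (LinearMap.BilinForm.toDual b hb).symm.toLinearMap, fun v w z => hC v w z,
    fun i j => ?_⟩
  rw [← sub_eq_zero]
  apply hn
  intro z
  rw [map_sub, sub_apply, sub_eq_zero]
  refine (hC _ _ z).trans ?_
  have key : ∀ l, christoffelForm (fderiv ℝ B y) (stdVec i) (stdVec j) (stdVec l)
      = B y (∑ k, coordChristoffel (gramMat B) k i j y • stdVec k) (stdVec l) := by
    intro l
    have h1 : (gramMat B y).mulVec ((gramMat B y)⁻¹.mulVec fun l =>
        christoffelForm (fderiv ℝ B y) (stdVec i) (stdVec j) (stdVec l)) = fun l =>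
        christoffelForm (fderiv ℝ B y) (stdVec i) (stdVec j) (stdVec l) := by
      rw [Matrix.mulVec_mulVec, Matrix.mul_nonsing_inv _ hdet, Matrix.one_mulVec]
    rw [← congrFun h1 l]
    simp only [map_sum, map_smul, sum_apply, smul_apply,
      smul_eq_mul, Matrix.mulVec, dotProduct]
    refine Finset.sum_congr rfl fun k _ => ?_
    rw [mul_comm, coordChristoffel, Finset.mul_sum]
    congr 1
    · refine Finset.sum_congr rfl fun q _ => ?_
      rw [hG, hG, hG, christoffelForm]; ring
    · exact hs _ _
  have hlin : ∀ z, christoffelForm (fderiv ℝ B y) (stdVec i) (stdVec j) z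
      = ∑ l, z l * christoffelForm (fderiv ℝ B y) (stdVec i) (stdVec j) (stdVec l) := by
    intro z
    have := congrArg (S (stdVec i) (stdVec j)) (eq_sum_stdVec z)
    rw [map_sum] at this
    simp only [map_smul, smul_eq_mul] at this
    exact this
  rw [hlin]
  conv_rhs => rw [eq_sum_stdVec z, map_sum]
  exact Finset.sum_congr rfl fun l _ => by rw [map_smul, smul_eq_mul, key]

/-- The trace of a bilinear map with respect to a bilinear form is invariant under pullback. -/
theorem trace_pullback {G G' : Matrix (Fin m) (Fin m) ℝ} (hG : IsUnit G.det)
    (A : Matrix (Fin m) (Fin m) ℝ) (hA : G = A.transpose * G' * A)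
    (h : Fin m → Fin m → F) :
    ∑ i, ∑ j, G⁻¹ i j • (∑ a, ∑ b, (A a i * A b j) • h a b) = ∑ a, ∑ b, G'⁻¹ a b • h a b := by
  have hdet : IsUnit (A.transpose.det * G'.det * A.det) := by
    rwa [hA, Matrix.det_mul, Matrix.det_mul] at hG
  have hAd : IsUnit A.det := isUnit_of_mul_isUnit_right hdet
  have hAtd : IsUnit A.transpose.det := by rwa [Matrix.det_transpose]
  have key : A * G⁻¹ * A.transpose = G'⁻¹ := by
    rw [hA, Matrix.mul_inv_rev, Matrix.mul_inv_rev]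
    rw [← Matrix.mul_assoc, Matrix.mul_nonsing_inv _ hAd, Matrix.one_mul, Matrix.mul_assoc,
      Matrix.nonsing_inv_mul _ hAtd, Matrix.mul_one]
  have h1 : ∀ a b, G'⁻¹ a b = ∑ i, ∑ j, G⁻¹ i j * (A a i * A b j) := by
    intro a b
    rw [← key, Matrix.mul_apply, Finset.sum_comm]
    refine Finset.sum_congr rfl fun j _ => ?_
    rw [Matrix.mul_apply, Finset.sum_mul]
    refine Finset.sum_congr rfl fun i _ => ?_
    rw [Matrix.transpose_apply]; ring
  simp only [h1, Finset.smul_sum, Finset.sum_smul, smul_smul]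
  calc _ = ∑ i, ∑ a, ∑ j, ∑ b, (G⁻¹ i j * (A a i * A b j)) • h a b :=
        Finset.sum_congr rfl fun i _ => Finset.sum_comm
    _ = ∑ a, ∑ i, ∑ j, ∑ b, (G⁻¹ i j * (A a i * A b j)) • h a b := Finset.sum_comm
    _ = _ := Finset.sum_congr rfl fun a _ => by
        rw [Finset.sum_comm (γ := Fin m) (s := Finset.univ) (t := Finset.univ)
          (f := fun b i => ∑ j, (G⁻¹ i j * (A a i * A b j)) • h a b)]
        exact Finset.sum_congr rfl fun i _ => Finset.sum_comm

/-- The Laplace operator as the trace of the Hessian, the Christoffel symbols being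
packaged into a bilinear map. -/
theorem coordLap_eq_trace {G : EuclideanSpace ℝ (Fin m) → Matrix (Fin m) (Fin m) ℝ}
    {w : EuclideanSpace ℝ (Fin m) → F} {y : EuclideanSpace ℝ (Fin m)} (hw : ContDiffAt ℝ 2 w y)
    {C : EuclideanSpace ℝ (Fin m) →ₗ[ℝ] EuclideanSpace ℝ (Fin m) →ₗ[ℝ]
        EuclideanSpace ℝ (Fin m)}
    (hC : ∀ i j, C (stdVec i) (stdVec j) = ∑ k, coordChristoffel G k i j y • stdVec k) :
    coordLap G w y = ∑ i, ∑ j, (G y)⁻¹ i j •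
      (fderiv ℝ (fderiv ℝ w) y (stdVec i) (stdVec j)
        - fderiv ℝ w y (C (stdVec i) (stdVec j))) := by
  unfold coordLap
  refine Finset.sum_congr rfl fun i _ => Finset.sum_congr rfl fun j _ => ?_
  rw [pderiv_pderiv hw, hC, map_sum]
  simp only [map_smul]
  rfl

/-- The coordinate Laplace operator is invariant under changes of coordinates. -/
theorem coordLap_pullback {B B' : EuclideanSpace ℝ (Fin m) → EuclideanSpace ℝ (Fin m) →L[ℝ]
    EuclideanSpace ℝ (Fin m) →L[ℝ] ℝ} {ψ : EuclideanSpace ℝ (Fin m) → EuclideanSpace ℝ (Fin m)}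
    {y : EuclideanSpace ℝ (Fin m)} {w : EuclideanSpace ℝ (Fin m) → F}
    (hB : DifferentiableAt ℝ B y) (hB' : DifferentiableAt ℝ B' (ψ y)) (hψ : ContDiffAt ℝ 2 ψ y)
    (hw : ContDiffAt ℝ 2 w (ψ y)) (hs' : ∀ v w, B' (ψ y) v w = B' (ψ y) w v)
    (hn : ∀ v, (∀ w, B y v w = 0) → v = 0) (hn' : ∀ v, (∀ w, B' (ψ y) v w = 0) → v = 0)
    (h : ∀ᶠ z in nhds y, ∀ v w, B z v w = B' (ψ z) (fderiv ℝ ψ z v) (fderiv ℝ ψ z w)) :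
    coordLap (gramMat B) (w ∘ ψ) y = coordLap (gramMat B') w (ψ y) := by
  have h0 := h.self_of_nhds
  have hs : ∀ v w, B y v w = B y w v := fun v w => by rw [h0, h0, hs']
  obtain ⟨C, hC, hCe⟩ := exists_christoffelMap hB hs hn
  obtain ⟨C', hC', hCe'⟩ := exists_christoffelMap hB' hs' hn'
  set A := fderiv ℝ ψ y with hA
  set H := fderiv ℝ (fderiv ℝ ψ) y with hH
  have hdψ : DifferentiableAt ℝ ψ y := hψ.differentiableAt (by norm_num)
  have hdA : DifferentiableAt ℝ (fderiv ℝ ψ) y :=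
    (hψ.fderiv_right (m := 1) (by norm_num)).differentiableAt (by norm_num)
  have hHs : ∀ v w, H v w = H w v :=
    fun v w => (hψ.isSymmSndFDerivAt (by simp)).eq v w
  have hAinj : Function.Injective A := by
    rw [injective_iff_map_eq_zero]
    intro v hv
    apply hn
    intro w
    rw [h0, hv]; simp
  have hAsurj : Function.Surjective A :=
    (LinearMap.injective_iff_surjective (f := A.toLinearMap)).1 hAinj
  have hdB : ∀ z v w, fderiv ℝ B y z v w
      = fderiv ℝ B' (ψ y) (A z) (A v) (A w) + B' (ψ y) (H z v) (A w) + B' (ψ y) (A v) (H z w) := by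
    intro z v w
    have e1 : fderiv ℝ B y z v w = fderiv ℝ (fun z => B z v w) y z := by
      rw [fderiv_clm_apply (by fun_prop) (by fun_prop), fderiv_clm_apply hB (by fun_prop)]
      simp
    have e2 : fderiv ℝ (fun z => B z v w) y
        = fderiv ℝ (fun z => B' (ψ z) (fderiv ℝ ψ z v) (fderiv ℝ ψ z w)) y :=
      Filter.EventuallyEq.fderiv_eq (h.mono fun z hz => hz v w)
    have d1 : DifferentiableAt ℝ (fun z => B' (ψ z)) y :=
      (fderiv_comp_dir (f := B') hB' hdψ).1
    have d2 : ∀ u, DifferentiableAt ℝ (fun z => fderiv ℝ ψ z u) y := fun u =>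
      hdA.clm_apply (by fun_prop)
    have d3 : ∀ u, fderiv ℝ (fun z => fderiv ℝ ψ z u) y z = H z u := fun u => by
      rw [fderiv_clm_apply hdA (by fun_prop)]; simp [hH]
    have d4 : fderiv ℝ (fun z => B' (ψ z)) y z = fderiv ℝ B' (ψ y) (A z) :=
      (fderiv_comp_dir (f := B') hB' hdψ).2 z
    rw [e1, e2, fderiv_clm_apply (d1.clm_apply (d2 v)) (d2 w), fderiv_clm_apply d1 (d2 v)]
    simp only [add_apply, ContinuousLinearMap.comp_apply,
      ContinuousLinearMap.flip_apply, d3, d4]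
    ring
  have hAC : ∀ v w, A (C v w) = C' (A v) (A w) + H v w := by
    intro v w
    rw [← sub_eq_zero]
    apply hn'
    intro z'
    obtain ⟨z, rfl⟩ := hAsurj z'
    rw [map_sub, map_add, sub_apply, add_apply, ← h0,
      hC, hC']
    simp only [christoffelForm, hdB]
    rw [hHs w v, hHs z v, hHs z w, hs' (A w) (H v z)]
    ring
  have hw' : ContDiffAt ℝ 2 (w ∘ ψ) y := hw.comp y hψ
  have hdw : DifferentiableAt ℝ (fderiv ℝ w) (ψ y) :=
    (hw.fderiv_right (m := 1) (by norm_num)).differentiableAt (by norm_num)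
  have h2 : ∀ v u, fderiv ℝ (fderiv ℝ (w ∘ ψ)) y v u
      = fderiv ℝ (fderiv ℝ w) (ψ y) (A v) (A u) + fderiv ℝ w (ψ y) (H v u) :=
    fderiv_fderiv_comp hw hψ
  have h1 : ∀ v, fderiv ℝ (w ∘ ψ) y v = fderiv ℝ w (ψ y) (A v) := fun v => by
    rw [fderiv_comp y (hw.differentiableAt (by norm_num)) hdψ]; rfl
  rw [coordLap_eq_trace hw' hCe, coordLap_eq_trace hw hCe']
  simp only [h1, h2, hAC, map_add, add_sub_add_right_eq_sub]
  have hG : gramMat B y = (Matrix.of fun a i => A (stdVec i) a).transpose * gramMat B' (ψ y)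
      * (Matrix.of fun a i => A (stdVec i) a) := by
    ext i j
    rw [Matrix.mul_apply]
    simp only [gramMat, Matrix.mul_apply, Matrix.transpose_apply, Matrix.of_apply,
      Finset.sum_mul]
    rw [h0, bilin_eq_sum_stdVec, Finset.sum_comm]
    exact Finset.sum_congr rfl fun a _ => Finset.sum_congr rfl fun b _ => by ring
  rw [← trace_pullback (isUnit_det_gramMat fun v hv => hn v fun w => (hs v w).trans (hv w)) _ hG]
  refine Finset.sum_congr rfl fun i _ => Finset.sum_congr rfl fun j _ => ?_
  congr 1
  have hbil : ∀ K : EuclideanSpace ℝ (Fin m) →ₗ[ℝ] EuclideanSpace ℝ (Fin m) →ₗ[ℝ] F,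
      K (A (stdVec i)) (A (stdVec j)) = ∑ a, ∑ b,
        (A (stdVec i) a * A (stdVec j) b) • K (stdVec a) (stdVec b) := by
    intro K
    conv_lhs => rw [eq_sum_stdVec (A (stdVec i)), eq_sum_stdVec (A (stdVec j))]
    simp only [map_sum, map_smul, LinearMap.sum_apply, LinearMap.smul_apply, Finset.smul_sum,
      smul_smul]
    rw [Finset.sum_comm]
    exact Finset.sum_congr rfl fun a _ => Finset.sum_congr rfl fun b _ => by rw [mul_comm]
  exact hbil ((fderiv ℝ (fderiv ℝ w) (ψ y)).toLinearMap₁₂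
    - C'.compr₂ (fderiv ℝ w (ψ y)).toLinearMap)

end Euclidean

section CoordSmooth

variable {m : ℕ} {F : Type*} [NormedAddCommGroup F] [NormedSpace ℝ F]

theorem _root_.ContDiffAt.pderiv {k : ℕ} {w : EuclideanSpace ℝ (Fin k) → F}
    {y : EuclideanSpace ℝ (Fin k)} (hw : ContDiffAt ℝ ∞ w y) (i : Fin k) :
    ContDiffAt ℝ ∞ (pderiv i w) y :=
  (hw.fderiv_right (m := ∞) le_rfl).clm_apply contDiffAt_const

theorem contDiffAt_det {ι : Type*} [Fintype ι] [DecidableEq ι] {E : Type*} [NormedAddCommGroup E]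
    [NormedSpace ℝ E] {G : E → Matrix ι ι ℝ} {y : E}
    (hG : ∀ i j, ContDiffAt ℝ ∞ (fun z => G z i j) y) :
    ContDiffAt ℝ ∞ (fun z => (G z).det) y := by
  simp only [Matrix.det_apply]
  refine ContDiffAt.sum fun σ _ => ContDiffAt.const_smul _ ?_
  exact contDiffAt_prod fun i _ => hG _ _

theorem contDiffAt_inv {ι : Type*} [Fintype ι] [DecidableEq ι] {E : Type*} [NormedAddCommGroup E]
    [NormedSpace ℝ E] {G : E → Matrix ι ι ℝ} {y : E}
    (hG : ∀ i j, ContDiffAt ℝ ∞ (fun z => G z i j) y) (hdet : IsUnit (G y).det) (i j : ι) :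
    ContDiffAt ℝ ∞ (fun z => (G z)⁻¹ i j) y := by
  simp only [Matrix.inv_def, Matrix.smul_apply, Ring.inverse_eq_inv', Matrix.adjugate_apply,
    smul_eq_mul]
  refine ((contDiffAt_det hG).inv hdet.ne_zero).mul (contDiffAt_det fun a b => ?_)
  by_cases h : a = j
  · subst h; simpa using contDiffAt_const
  · simpa [Matrix.updateRow_ne h] using hG a b

theorem contDiffAt_coordLap {G : EuclideanSpace ℝ (Fin m) → Matrix (Fin m) (Fin m) ℝ}
    {w : EuclideanSpace ℝ (Fin m) → F} {y : EuclideanSpace ℝ (Fin m)}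
    (hG : ∀ i j, ContDiffAt ℝ ∞ (fun z => G z i j) y) (hdet : IsUnit (G y).det)
    (hw : ContDiffAt ℝ ∞ w y) : ContDiffAt ℝ ∞ (coordLap G w) y := by
  unfold coordLap
  refine ContDiffAt.sum fun i _ => ContDiffAt.sum fun j _ =>
    (contDiffAt_inv hG hdet i j).smul (((hw.pderiv j).pderiv i).sub
      (ContDiffAt.sum fun k _ => ContDiffAt.smul ?_ (hw.pderiv k)))
  unfold coordChristoffel
  exact contDiffAt_const.mul (ContDiffAt.sum fun l _ => (contDiffAt_inv hG hdet k l).mul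
    ((((hG j l).pderiv i).add ((hG i l).pderiv j)).sub ((hG i j).pderiv l)))

theorem pderiv_congr {k : ℕ} {w w' : EuclideanSpace ℝ (Fin k) → F}
    {y : EuclideanSpace ℝ (Fin k)} (h : w =ᶠ[nhds y] w') (i : Fin k) :
    pderiv i w =ᶠ[nhds y] pderiv i w' :=
  (h.fderiv (𝕜 := ℝ)).mono fun z hz => by simp only [pderiv, hz]

theorem coordLap_congr {G : EuclideanSpace ℝ (Fin m) → Matrix (Fin m) (Fin m) ℝ}
    {w w' : EuclideanSpace ℝ (Fin m) → F} {y : EuclideanSpace ℝ (Fin m)}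
    (h : w =ᶠ[nhds y] w') : coordLap G w y = coordLap G w' y := by
  unfold coordLap
  refine Finset.sum_congr rfl fun i _ => Finset.sum_congr rfl fun j _ => ?_
  rw [(pderiv_congr (pderiv_congr h j) i).self_of_nhds]
  simp only [(pderiv_congr h _).self_of_nhds]

end CoordSmooth

section Chart

variable {m : ℕ} {M : Type*} [TopologicalSpace M] [ChartedSpace (EuclideanSpace ℝ (Fin m)) M]
  {F : Type*} [NormedAddCommGroup F] [NormedSpace ℝ F]

theorem contMDiffAt_iff_chart {u : M → F} {x : M} {n : ℕ∞ω} :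
    ContMDiffAt (𝓡 m) 𝓘(ℝ, F) n u x ↔ ContinuousAt u x ∧
      ContDiffAt ℝ n (u ∘ (chartAt (EuclideanSpace ℝ (Fin m)) x).symm)
        (chartAt (EuclideanSpace ℝ (Fin m)) x x) := by
  rw [contMDiffAt_iff]
  simp [contDiffWithinAt_univ, chartAt_self_eq]

end Chart

section Chart

variable {m : ℕ} {M : Type*} [TopologicalSpace M]
  [ChartedSpace (EuclideanSpace ℝ (Fin m)) M] [IsManifold (𝓡 m) ∞ M]
  {F : Type*} [NormedAddCommGroup F] [NormedSpace ℝ F]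

/-- The differential of the inverse of the chart around `x`, all tangent spaces being
identified with the model space. -/
def chartDiff (x : M) (y : EuclideanSpace ℝ (Fin m)) :
    EuclideanSpace ℝ (Fin m) →L[ℝ] EuclideanSpace ℝ (Fin m) :=
  mfderiv (𝓡 m) (𝓡 m) (chartAt (EuclideanSpace ℝ (Fin m)) x).symm y

/-- The metric, all tangent spaces being identified with the model space. -/
def metricAt (g : RMetric m M) (p : M) :
    EuclideanSpace ℝ (Fin m) →L[ℝ] EuclideanSpace ℝ (Fin m) →L[ℝ] ℝ :=
  g.inner p

/-- The metric read in the chart around `x`. -/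
def chartMetric (g : RMetric m M) (x : M) (y : EuclideanSpace ℝ (Fin m)) :
    EuclideanSpace ℝ (Fin m) →L[ℝ] EuclideanSpace ℝ (Fin m) →L[ℝ] ℝ :=
  (metricAt g ((chartAt (EuclideanSpace ℝ (Fin m)) x).symm y)).bilinearComp
    (chartDiff x y) (chartDiff x y)

theorem chartMetric_apply (g : RMetric m M) (x : M) (y v w : EuclideanSpace ℝ (Fin m)) :
    chartMetric g x y v w = metricAt g ((chartAt (EuclideanSpace ℝ (Fin m)) x).symm y)
      (chartDiff x y v) (chartDiff x y w) := rfl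

theorem lap_eq_coordLap (g : RMetric m M) (u : M → F) (x : M) :
    lap g u x = coordLap (gramMat (chartMetric g x))
      (u ∘ (chartAt (EuclideanSpace ℝ (Fin m)) x).symm)
      (chartAt (EuclideanSpace ℝ (Fin m)) x x) := rfl

theorem chartMetric_symm (g : RMetric m M) (x : M) (y v w : EuclideanSpace ℝ (Fin m)) :
    chartMetric g x y v w = chartMetric g x y w v := g.symm _ _ _

theorem chartDiff_bijective (x : M) {y : EuclideanSpace ℝ (Fin m)}
    (hy : y ∈ (chartAt (EuclideanSpace ℝ (Fin m)) x).target) :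
    Function.Bijective (chartDiff x y) := by
  have h := (mdifferentiable_chart (I := 𝓡 m) x).symm
  exact h.mfderiv_bijective hy

theorem chartMetric_nondegenerate (g : RMetric m M) (x : M) {y : EuclideanSpace ℝ (Fin m)}
    (hy : y ∈ (chartAt (EuclideanSpace ℝ (Fin m)) x).target) (v : EuclideanSpace ℝ (Fin m))
    (hv : ∀ w, chartMetric g x y v w = 0) : v = 0 := by
  by_contra h
  have h1 : chartDiff x y v ≠ 0 := fun h0 =>
    h ((chartDiff_bijective x hy).1 (h0.trans (map_zero _).symm))
  exact (g.pos _ _ h1).ne' (hv v)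

theorem isUnit_det_gram (g : RMetric m M) (x : M) {y : EuclideanSpace ℝ (Fin m)}
    (hy : y ∈ (chartAt (EuclideanSpace ℝ (Fin m)) x).target) :
    IsUnit (gramMat (chartMetric g x) y).det :=
  isUnit_det_gramMat fun v hv => chartMetric_nondegenerate g x hy v fun w =>
    (chartMetric_symm g x y v w).trans (hv w)

theorem two_le_infty : (2 : ℕ∞ω) ≤ ∞ := WithTop.coe_le_coe.2 le_top

theorem contDiffAt_chart {u : M → F} (x : M) {z : M} {n : ℕ∞ω} (hn : n ≤ ∞)
    (hz : z ∈ (chartAt (EuclideanSpace ℝ (Fin m)) x).source)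
    (hu : ContMDiffAt (𝓡 m) 𝓘(ℝ, F) n u z) :
    ContDiffAt ℝ n (u ∘ (chartAt (EuclideanSpace ℝ (Fin m)) x).symm)
        (chartAt (EuclideanSpace ℝ (Fin m)) x z) := by
  rw [← contMDiffAt_iff_contDiffAt]
  have h1 : ContMDiffAt (𝓡 m) (𝓡 m) ∞ (chartAt (EuclideanSpace ℝ (Fin m)) x).symm
      (chartAt (EuclideanSpace ℝ (Fin m)) x z) :=
    contMDiffOn_chart_symm.contMDiffAt ((chartAt (EuclideanSpace ℝ (Fin m)) x).open_target.mem_nhds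
      ((chartAt (EuclideanSpace ℝ (Fin m)) x).map_source hz))
  refine ContMDiffAt.comp _ ?_ (h1.of_le hn)
  rwa [(chartAt (EuclideanSpace ℝ (Fin m)) x).left_inv hz]

theorem contMDiffAt_symmL (x : M) (v : EuclideanSpace ℝ (Fin m)) :
    ContMDiffAt (𝓡 m) ((𝓡 m).prod 𝓘(ℝ, EuclideanSpace ℝ (Fin m))) ∞
      (fun p : M => (Bundle.TotalSpace.mk' (EuclideanSpace ℝ (Fin m)) p
        ((trivializationAt (EuclideanSpace ℝ (Fin m)) (TangentSpace (𝓡 m)) x).symmL ℝ p v))) x := by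
  rw [Bundle.contMDiffAt_section]
  refine (contMDiffAt_const (c := v)).congr_of_eventuallyEq ?_
  filter_upwards [(chartAt (EuclideanSpace ℝ (Fin m)) x).open_source.mem_nhds
    (mem_chart_source _ x)] with p hp
  have hp' : p ∈ (trivializationAt (EuclideanSpace ℝ (Fin m))
      (TangentSpace (𝓡 m) : M → Type _) x).baseSet := by simpa using hp
  have := (trivializationAt (EuclideanSpace ℝ (Fin m))
      (TangentSpace (𝓡 m) : M → Type _) x).apply_mk_symm hp' v
  rw [Bundle.Trivialization.symmL_apply _ hp']
  exact congrArg Prod.snd this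

theorem symmL_eq_chartDiff {x p : M} (hp : p ∈ (chartAt (EuclideanSpace ℝ (Fin m)) x).source)
    (v : EuclideanSpace ℝ (Fin m)) :
    (trivializationAt (EuclideanSpace ℝ (Fin m)) (TangentSpace (𝓡 m)) x).symmL ℝ p v =
      (chartDiff x (chartAt (EuclideanSpace ℝ (Fin m)) x p) v : EuclideanSpace ℝ (Fin m)) := by
  rw [TangentBundle.symmL_trivializationAt (I := 𝓡 m) hp]
  have h : mfderivWithin 𝓘(ℝ, EuclideanSpace ℝ (Fin m)) (𝓡 m) (extChartAt (𝓡 m) x).symm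
      (Set.range (𝓡 m)) (extChartAt (𝓡 m) x p)
      = mfderiv (𝓡 m) (𝓡 m) (chartAt (EuclideanSpace ℝ (Fin m)) x).symm
        (chartAt (EuclideanSpace ℝ (Fin m)) x p) := by
    rw [modelWithCornersSelf_coe, Set.range_id, mfderivWithin_univ]
    simp only [mfld_simps]
    rfl
  exact congrArg (fun D : EuclideanSpace ℝ (Fin m) →L[ℝ] EuclideanSpace ℝ (Fin m) => D v) h

theorem contDiffAt_chartMetric_apply (g : RMetric m M) (x : M) (v w : EuclideanSpace ℝ (Fin m)) :
    ContDiffAt ℝ ∞ (fun y => chartMetric g x y v w)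
      (chartAt (EuclideanSpace ℝ (Fin m)) x x) := by
  have h1 : ContMDiffAt (𝓡 m) ((𝓡 m).prod 𝓘(ℝ)) ∞
      (fun p : M => Bundle.TotalSpace.mk' ℝ (E := Bundle.Trivial M ℝ) p
        (g.inner p
          ((trivializationAt (EuclideanSpace ℝ (Fin m)) (TangentSpace (𝓡 m)) x).symmL ℝ p v)
          ((trivializationAt (EuclideanSpace ℝ (Fin m)) (TangentSpace (𝓡 m)) x).symmL ℝ p w)))
      x := by
    apply ContMDiffAt.clm_bundle_apply₂ (F₁ := EuclideanSpace ℝ (Fin m))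
      (F₂ := EuclideanSpace ℝ (Fin m))
    · exact g.contMDiff.contMDiffAt
    · exact contMDiffAt_symmL x v
    · exact contMDiffAt_symmL x w
  rw [Bundle.contMDiffAt_totalSpace] at h1
  have h2 := (contMDiffAt_iff_chart.1 h1.2).2
  refine h2.congr_of_eventuallyEq ?_
  filter_upwards [(chartAt (EuclideanSpace ℝ (Fin m)) x).open_target.mem_nhds
    (mem_chart_target _ x)] with y hy
  have hs := (chartAt (EuclideanSpace ℝ (Fin m)) x).map_target hy
  have hr := (chartAt (EuclideanSpace ℝ (Fin m)) x).right_inv hy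
  have hv := fun v => symmL_eq_chartDiff hs v
  rw [hr] at hv
  change metricAt g _ (chartDiff x y v) (chartDiff x y w) = metricAt g _ _ _
  rw [← hv v, ← hv w]

theorem contDiffAt_smul_const {E V : Type*} [NormedAddCommGroup E] [NormedSpace ℝ E]
    [NormedAddCommGroup V] [NormedSpace ℝ V] {f : E → ℝ} {y : E} {n : ℕ∞ω}
    (hf : ContDiffAt ℝ n f y) (c : V) : ContDiffAt ℝ n (fun z => f z • c) y :=
  hf.smul contDiffAt_const

theorem contDiffAt_chartMetric (g : RMetric m M) (x : M) :
    ContDiffAt ℝ ∞ (chartMetric g x) (chartAt (EuclideanSpace ℝ (Fin m)) x x) := by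
  have h : chartMetric g x = fun y => ∑ i, ∑ j, chartMetric g x y (stdVec i) (stdVec j) •
      ((ContinuousLinearMap.mul ℝ ℝ).bilinearComp (EuclideanSpace.proj i)
        (EuclideanSpace.proj j)) := by
    ext y v w
    rw [bilin_eq_sum_stdVec]
    simp [mul_comm]
  rw [h]
  exact ContDiffAt.sum fun i _ => ContDiffAt.sum fun j _ =>
    contDiffAt_smul_const (contDiffAt_chartMetric_apply g x _ _) _

theorem chartDiff_transition {x z : M} {y : EuclideanSpace ℝ (Fin m)}
    (hy : y ∈ (chartAt (EuclideanSpace ℝ (Fin m)) z).target)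
    (hy' : (chartAt (EuclideanSpace ℝ (Fin m)) z).symm y ∈
      (chartAt (EuclideanSpace ℝ (Fin m)) x).source) (v : EuclideanSpace ℝ (Fin m)) :
    chartDiff z y v = chartDiff x ((chartAt (EuclideanSpace ℝ (Fin m)) x ∘
          (chartAt (EuclideanSpace ℝ (Fin m)) z).symm) y)
        (fderiv ℝ (chartAt (EuclideanSpace ℝ (Fin m)) x ∘
          (chartAt (EuclideanSpace ℝ (Fin m)) z).symm) y v) := by
  set e := chartAt (EuclideanSpace ℝ (Fin m)) x with he
  set e' := chartAt (EuclideanSpace ℝ (Fin m)) z with he'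
  have d1 : MDifferentiableAt (𝓡 m) (𝓡 m) e'.symm y :=
    mdifferentiableAt_atlas_symm (chart_mem_atlas _ z) hy
  have d2 : MDifferentiableAt (𝓡 m) (𝓡 m) e (e'.symm y) :=
    mdifferentiableAt_atlas (chart_mem_atlas _ x) hy'
  have d3 : MDifferentiableAt (𝓡 m) (𝓡 m) e.symm ((e ∘ e'.symm) y) :=
    mdifferentiableAt_atlas_symm (chart_mem_atlas _ x) (e.map_source hy')
  have h1 : e'.symm =ᶠ[nhds y] e.symm ∘ (e ∘ e'.symm) := by
    filter_upwards [(e'.continuousAt_symm hy).eventually (e.open_source.mem_nhds hy')] with q hq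
    exact (e.left_inv hq).symm
  have h2 := h1.mfderiv_eq (I := 𝓡 m) (I' := 𝓡 m)
  rw [mfderiv_comp y d3 (d2.comp y d1)] at h2
  have h3 := mfderiv_eq_fderiv (f := e ∘ e'.symm) (x := y) (𝕜 := ℝ)
  change mfderiv (𝓡 m) (𝓡 m) (e ∘ e'.symm) y = _ at h3
  rw [h3] at h2
  exact congrArg (fun D : EuclideanSpace ℝ (Fin m) →L[ℝ] EuclideanSpace ℝ (Fin m) => D v) h2

theorem chartMetric_transition (g : RMetric m M) {x z : M}
    (hz : z ∈ (chartAt (EuclideanSpace ℝ (Fin m)) x).source) :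
    ContDiffAt ℝ ∞ (chartAt (EuclideanSpace ℝ (Fin m)) x ∘
      (chartAt (EuclideanSpace ℝ (Fin m)) z).symm) (chartAt (EuclideanSpace ℝ (Fin m)) z z) ∧
    ∀ᶠ y in nhds (chartAt (EuclideanSpace ℝ (Fin m)) z z), ∀ v w,
      chartMetric g z y v w = chartMetric g x ((chartAt (EuclideanSpace ℝ (Fin m)) x ∘
        (chartAt (EuclideanSpace ℝ (Fin m)) z).symm) y)
        (fderiv ℝ (chartAt (EuclideanSpace ℝ (Fin m)) x ∘
          (chartAt (EuclideanSpace ℝ (Fin m)) z).symm) y v)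
        (fderiv ℝ (chartAt (EuclideanSpace ℝ (Fin m)) x ∘
          (chartAt (EuclideanSpace ℝ (Fin m)) z).symm) y w) := by
  have hz' : ContMDiffAt (𝓡 m) 𝓘(ℝ, EuclideanSpace ℝ (Fin m)) ∞
      (chartAt (EuclideanSpace ℝ (Fin m)) x) z := contMDiffOn_chart.contMDiffAt
    ((chartAt (EuclideanSpace ℝ (Fin m)) x).open_source.mem_nhds hz)
  refine ⟨contDiffAt_chart z le_rfl (mem_chart_source _ z) hz', ?_⟩
  set e := chartAt (EuclideanSpace ℝ (Fin m)) x with he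
  set e' := chartAt (EuclideanSpace ℝ (Fin m)) z with he'
  have h1 : ∀ᶠ y in nhds (e' z), e'.symm y ∈ e.source :=
    (e'.continuousAt_symm (mem_chart_target _ z)).eventually
      (by rw [e'.left_inv (mem_chart_source _ z)]; exact e.open_source.mem_nhds hz)
  filter_upwards [h1, e'.open_target.mem_nhds (mem_chart_target _ z)] with y hy hy' v w
  rw [chartMetric_apply, chartMetric_apply, ← chartDiff_transition hy' hy,
    ← chartDiff_transition hy' hy, Function.comp_apply, e.left_inv hy]

/-- The Laplace-Beltrami operator may be computed in any nearby chart. -/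
theorem lap_eventually_eq (g : RMetric m M) {u : M → F} {x : M}
    (hu : ContMDiffAt (𝓡 m) 𝓘(ℝ, F) ∞ u x) :
    ∀ᶠ z in nhds x, lap g u z = coordLap (gramMat (chartMetric g x))
      (u ∘ (chartAt (EuclideanSpace ℝ (Fin m)) x).symm)
      (chartAt (EuclideanSpace ℝ (Fin m)) x z) := by
  set e := chartAt (EuclideanSpace ℝ (Fin m)) x with he
  have hu2 : ∀ᶠ z in nhds x, ContMDiffAt (𝓡 m) 𝓘(ℝ, F) 2 u z :=
    (contMDiffAt_iff_contMDiffAt_nhds (by simp)).1 (hu.of_le two_le_infty)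
  have hB : ∀ᶠ z in nhds x, ContDiffAt ℝ 1 (chartMetric g x) (e z) :=
    (e.continuousAt (mem_chart_source _ x)).eventually
      (((contDiffAt_chartMetric g x).of_le (one_le_two.trans two_le_infty)).eventually (by simp))
  filter_upwards [hu2, hB, e.open_source.mem_nhds (mem_chart_source _ x)] with z hz hBz hzs
  set e' := chartAt (EuclideanSpace ℝ (Fin m)) z with he'
  obtain ⟨h1, h2⟩ := chartMetric_transition g hzs
  have hez : (e ∘ e'.symm) (e' z) = e z := by
    rw [Function.comp_apply, e'.left_inv (mem_chart_source _ z)]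
  have key := coordLap_pullback (B := chartMetric g z) (B' := chartMetric g x) (ψ := e ∘ e'.symm)
    (y := e' z) (w := u ∘ e.symm)
    ((contDiffAt_chartMetric g z).differentiableAt (by simp))
    (by rw [hez]; exact hBz.differentiableAt (by norm_num))
    (h1.of_le two_le_infty)
    (by rw [hez]; exact contDiffAt_chart x two_le_infty hzs hz)
    (chartMetric_symm g x _)
    (chartMetric_nondegenerate g z (mem_chart_target _ z))
    (by rw [hez]; exact chartMetric_nondegenerate g x (e.map_source hzs)) h2
  rw [lap_eq_coordLap]
  rw [hez] at key
  rw [← key]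
  apply coordLap_congr
  have : ∀ᶠ y in nhds (e' z), e'.symm y ∈ e.source :=
    (e'.continuousAt_symm (mem_chart_target _ z)).eventually
      (by rw [e'.left_inv (mem_chart_source _ z)]; exact e.open_source.mem_nhds hzs)
  filter_upwards [this] with y hy
  simp only [Function.comp_apply, e.left_inv hy]; rfl

theorem _root_.ContMDiffAt.lap (g : RMetric m M) {u : M → F} {x : M}
    (hu : ContMDiffAt (𝓡 m) 𝓘(ℝ, F) ∞ u x) : ContMDiffAt (𝓡 m) 𝓘(ℝ, F) ∞ (lap g u) x := by
  have h := contDiffAt_coordLap (G := gramMat (chartMetric g x))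
    (fun i j => ((contDiffAt_chartMetric g x).clm_apply contDiffAt_const).clm_apply
      contDiffAt_const) (isUnit_det_gram g x (mem_chart_target _ x)) (contMDiffAt_iff_chart.1 hu).2
  have h' : ContMDiffAt (𝓡 m) 𝓘(ℝ, F) ∞ ((coordLap (gramMat (chartMetric g x))
      (u ∘ (chartAt (EuclideanSpace ℝ (Fin m)) x).symm)) ∘
      (chartAt (EuclideanSpace ℝ (Fin m)) x)) x :=
    h.contMDiffAt.comp x (contMDiffOn_chart.contMDiffAt
      ((chartAt (EuclideanSpace ℝ (Fin m)) x).open_source.mem_nhds (mem_chart_source _ x)))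
  exact h'.congr_of_eventuallyEq (lap_eventually_eq g hu)

end Chart

section Differential

variable {m : ℕ} {M : Type*} [TopologicalSpace M] [ChartedSpace (EuclideanSpace ℝ (Fin m)) M]
  {F F' : Type*} [NormedAddCommGroup F] [NormedSpace ℝ F] [NormedAddCommGroup F']
  [NormedSpace ℝ F']

theorem contMDiffAt_coord {n : ℕ} {φ : M → EuclideanSpace ℝ (Fin n)} {x : M}
    (hφ : ContMDiffAt (𝓡 m) 𝓘(ℝ, EuclideanSpace ℝ (Fin n)) ∞ φ x) (α : Fin n) :
    ContMDiffAt (𝓡 m) 𝓘(ℝ, ℝ) ∞ (fun z => φ z α) x :=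
  (EuclideanSpace.proj (𝕜 := ℝ) α).contMDiff.contMDiffAt.comp x hφ

theorem dmap_comp {u : M → F} {f : F → F'} {x : M} (hf : DifferentiableAt ℝ f (u x))
    (hu : MDifferentiableAt (𝓡 m) 𝓘(ℝ, F) u x) (V : TangentSpace (𝓡 m) x) :
    dmap (f ∘ u) x V = fderiv ℝ f (u x) (dmap u x V) := by
  have h := mfderiv_comp (I := 𝓡 m) (I' := 𝓘(ℝ, F)) (I'' := 𝓘(ℝ, F')) x
    hf.mdifferentiableAt hu
  rw [mfderiv_eq_fderiv] at h
  exact congrArg (fun D : EuclideanSpace ℝ (Fin m) →L[ℝ] F' => D V) h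

theorem dmap_coord {n : ℕ} {φ : M → EuclideanSpace ℝ (Fin n)} {x : M}
    (hφ : MDifferentiableAt (𝓡 m) 𝓘(ℝ, EuclideanSpace ℝ (Fin n)) φ x) (α : Fin n)
    (V : TangentSpace (𝓡 m) x) : dmap (fun z => φ z α) x V = (dmap φ x V : EuclideanSpace ℝ (Fin n)) α := by
  have := dmap_comp (f := EuclideanSpace.proj (𝕜 := ℝ) α)
    (EuclideanSpace.proj (𝕜 := ℝ) α).differentiableAt hφ V
  rw [ContinuousLinearMap.fderiv] at this
  exact this

end Differential

section Rules

variable {m : ℕ} {M : Type*} [TopologicalSpace M]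
  [ChartedSpace (EuclideanSpace ℝ (Fin m)) M] [IsManifold (𝓡 m) ∞ M]
  {F F' : Type*} [NormedAddCommGroup F] [NormedSpace ℝ F] [NormedAddCommGroup F']
  [NormedSpace ℝ F']

/-- Composition formula for the coordinate Laplace operator. -/
theorem coordLap_comp (G : EuclideanSpace ℝ (Fin m) → Matrix (Fin m) (Fin m) ℝ)
    {w : EuclideanSpace ℝ (Fin m) → F} {f : F → F'} {y : EuclideanSpace ℝ (Fin m)}
    (hf : ContDiffAt ℝ 2 f (w y)) (hw : ContDiffAt ℝ 2 w y) :
    coordLap G (f ∘ w) y = fderiv ℝ f (w y) (coordLap G w y) +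
      ∑ i, ∑ j, (G y)⁻¹ i j • fderiv ℝ (fderiv ℝ f) (w y) (pderiv i w y) (pderiv j w y) := by
  have h1 : ∀ k, pderiv k (f ∘ w) y = fderiv ℝ f (w y) (pderiv k w y) := fun k => by
    rw [pderiv, fderiv_comp y (hf.differentiableAt (by norm_num))
      (hw.differentiableAt (by norm_num))]
    rfl
  unfold coordLap
  simp only [map_sum, map_smul, map_sub, ← Finset.sum_add_distrib, ← smul_add]
  refine Finset.sum_congr rfl fun i _ => Finset.sum_congr rfl fun j _ => ?_
  rw [pderiv_pderiv (hf.comp y hw), fderiv_fderiv_comp hf hw, pderiv_pderiv hw]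
  simp only [h1]
  congr 1
  change _ = _ + fderiv ℝ (fderiv ℝ f) (w y) (fderiv ℝ w y (stdVec i)) (fderiv ℝ w y (stdVec j))
  abel

/-- The coordinate expression of `g(∇u, ∇v)`. -/
theorem gradInner_eq_sum (g : RMetric m M) {u v : M → ℝ} {x : M}
    (hu : MDifferentiableAt (𝓡 m) 𝓘(ℝ, ℝ) u x) (hv : MDifferentiableAt (𝓡 m) 𝓘(ℝ, ℝ) v x) :
    gradInner g u v x = ∑ i, ∑ j,
      (gramMat (chartMetric g x) (chartAt (EuclideanSpace ℝ (Fin m)) x x))⁻¹ i j *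
        (pderiv i (u ∘ (chartAt (EuclideanSpace ℝ (Fin m)) x).symm)
          (chartAt (EuclideanSpace ℝ (Fin m)) x x) *
        pderiv j (v ∘ (chartAt (EuclideanSpace ℝ (Fin m)) x).symm)
          (chartAt (EuclideanSpace ℝ (Fin m)) x x)) := by
  set e := chartAt (EuclideanSpace ℝ (Fin m)) x with he
  have hx : e.symm (e x) = x := e.left_inv (mem_chart_source _ x)
  have hd : ∀ {u : M → ℝ}, MDifferentiableAt (𝓡 m) 𝓘(ℝ, ℝ) u x → ∀ ξ : EuclideanSpace ℝ (Fin m),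
      fderiv ℝ (u ∘ e.symm) (e x) ξ = (dmap u x : EuclideanSpace ℝ (Fin m) →L[ℝ] ℝ)
        (chartDiff x (e x) ξ) := by
    intro u hu ξ
    have d1 : MDifferentiableAt (𝓡 m) (𝓡 m) e.symm (e x) :=
      mdifferentiableAt_atlas_symm (chart_mem_atlas _ x) (mem_chart_target _ x)
    have h1 := mfderiv_comp (I := 𝓡 m) (I' := 𝓡 m) (I'' := 𝓘(ℝ, ℝ)) (g := u) (f := e.symm) (e x)
      (by rwa [hx]) d1
    rw [← mfderiv_eq_fderiv]
    have h2 := congrArg (fun D : EuclideanSpace ℝ (Fin m) →L[ℝ] ℝ => D ξ) h1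
    refine h2.trans ?_
    have h3 : ∀ p, p = x → ∀ V : EuclideanSpace ℝ (Fin m),
      (dmap u p : EuclideanSpace ℝ (Fin m) →L[ℝ] ℝ) V =
      (dmap u x : EuclideanSpace ℝ (Fin m) →L[ℝ] ℝ) V := fun p hp V => by subst hp; rfl
    exact h3 _ hx _
  have hB : ∀ v w, chartMetric g x (e x) v w
      = metricAt g x (chartDiff x (e x) v) (chartDiff x (e x) w) := fun v w => by
    rw [chartMetric_apply, hx]
  have hsurj := (chartDiff_bijective x (mem_chart_target (EuclideanSpace ℝ (Fin m)) x)).2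
  obtain ⟨ξ, hξ⟩ := hsurj (grad g u x)
  obtain ⟨η, hη⟩ := hsurj (grad g v x)
  have hgu : ∀ w, chartMetric g x (e x) ξ w = fderiv ℝ (u ∘ e.symm) (e x) w := fun w => by
    rw [hB, hξ, hd hu]; exact inner_grad g u x _
  have hgv : ∀ w, chartMetric g x (e x) η w = fderiv ℝ (v ∘ e.symm) (e x) w := fun w => by
    rw [hB, hη, hd hv]; exact inner_grad g v x _
  have h0 : gradInner g u v x = chartMetric g x (e x) η ξ := by
    rw [hB, hξ, hη]; exact g.symm _ _ _
  set G := gramMat (chartMetric g x) (e x) with hG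
  have hdet : IsUnit G.det := isUnit_det_gram g x (mem_chart_target _ x)
  have h1 : G.mulVec ξ = fun i => pderiv i (u ∘ e.symm) (e x) := by
    funext i
    change _ = fderiv ℝ (u ∘ e.symm) (e x) (stdVec i)
    rw [← hgu, chartMetric_symm]
    conv_rhs => rw [eq_sum_stdVec ξ, map_sum]
    simp [Matrix.mulVec, dotProduct, hG, gramMat, mul_comm]
  have h2 : G⁻¹.mulVec (fun i => pderiv i (u ∘ e.symm) (e x)) = ξ := by
    rw [← h1, Matrix.mulVec_mulVec, Matrix.nonsing_inv_mul _ hdet, Matrix.one_mulVec]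
  have h3 : ∀ i j, G⁻¹ i j = G⁻¹ j i := by
    have : G.transpose = G := by
      ext i j; exact chartMetric_symm g x _ _ _
    intro i j
    conv_lhs => rw [← this, ← Matrix.transpose_nonsing_inv, Matrix.transpose_apply]
  rw [h0, hgv]
  conv_lhs => rw [eq_sum_stdVec ξ, map_sum]
  rw [Finset.sum_comm]
  refine Finset.sum_congr rfl fun j _ => ?_
  rw [map_smul, smul_eq_mul, ← congrFun h2 j, Matrix.mulVec, dotProduct, Finset.sum_mul]
  refine Finset.sum_congr rfl fun i _ => ?_
  rw [h3 i j]
  simp only [pderiv]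
  ring

theorem lap_congr (g : RMetric m M) {u v : M → F} {x : M} (h : u =ᶠ[nhds x] v) :
    lap g u x = lap g v x := by
  rw [lap_eq_coordLap, lap_eq_coordLap]
  apply coordLap_congr
  have := (chartAt (EuclideanSpace ℝ (Fin m)) x).continuousAt_symm (mem_chart_target _ x)
  rw [ContinuousAt, (chartAt (EuclideanSpace ℝ (Fin m)) x).left_inv (mem_chart_source _ x)] at this
  exact this.eventually h

/-- Composition formula for the Laplace-Beltrami operator. -/
theorem lap_comp (g : RMetric m M) {u : M → F} {f : F → F'} {x : M}
    (hf : ContDiffAt ℝ 2 f (u x)) (hu : ContMDiffAt (𝓡 m) 𝓘(ℝ, F) ∞ u x) :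
    lap g (f ∘ u) x = fderiv ℝ f (u x) (lap g u x) + ∑ i, ∑ j,
      (gramMat (chartMetric g x) (chartAt (EuclideanSpace ℝ (Fin m)) x x))⁻¹ i j •
        fderiv ℝ (fderiv ℝ f) (u x)
          (pderiv i (u ∘ (chartAt (EuclideanSpace ℝ (Fin m)) x).symm)
            (chartAt (EuclideanSpace ℝ (Fin m)) x x))
          (pderiv j (u ∘ (chartAt (EuclideanSpace ℝ (Fin m)) x).symm)
            (chartAt (EuclideanSpace ℝ (Fin m)) x x)) := by
  have hx : (u ∘ (chartAt (EuclideanSpace ℝ (Fin m)) x).symm)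
      (chartAt (EuclideanSpace ℝ (Fin m)) x x) = u x := by
    rw [Function.comp_apply, (chartAt (EuclideanSpace ℝ (Fin m)) x).left_inv (mem_chart_source _ x)]
  have h := coordLap_comp (gramMat (chartMetric g x)) (f := f) (by rwa [hx])
    ((contMDiffAt_iff_chart.1 hu).2.of_le two_le_infty)
  rw [hx] at h
  exact h

theorem lap_clm (g : RMetric m M) (ℓ : F →L[ℝ] F') {u : M → F} {x : M}
    (hu : ContMDiffAt (𝓡 m) 𝓘(ℝ, F) ∞ u x) :
    lap g (fun z => ℓ (u z)) x = ℓ (lap g u x) := by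
  have h := lap_comp g (f := ℓ) ℓ.contDiff.contDiffAt hu
  have h2 : fderiv ℝ ℓ = fun _ => ℓ := funext fun _ => ℓ.fderiv
  rw [h2] at h
  refine h.trans ?_
  simp

theorem pderiv_clm {k : ℕ} (ℓ : F →L[ℝ] F') {w : EuclideanSpace ℝ (Fin k) → F}
    {y : EuclideanSpace ℝ (Fin k)} (hw : DifferentiableAt ℝ w y) (i : Fin k) :
    pderiv i (fun z => ℓ (w z)) y = ℓ (pderiv i w y) := by
  rw [pderiv, (fderiv_comp_dir ℓ.differentiableAt hw).2, ℓ.fderiv]; rfl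

theorem fderiv_fderiv_eq_sum {n : ℕ} {f : EuclideanSpace ℝ (Fin n) → ℝ}
    {p : EuclideanSpace ℝ (Fin n)} (hf : ContDiffAt ℝ 2 f p) (a b : EuclideanSpace ℝ (Fin n)) :
    fderiv ℝ (fderiv ℝ f) p a b
      = ∑ α, ∑ β, a α * b β * pderiv α (pderiv β f) p := by
  rw [bilin_eq_sum_stdVec]
  simp only [pderiv_pderiv hf]

theorem fderiv_eq_sum {n : ℕ} (f : EuclideanSpace ℝ (Fin n) → ℝ)
    (p a : EuclideanSpace ℝ (Fin n)) : fderiv ℝ f p a = ∑ α, a α * pderiv α f p := by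
  conv_lhs => rw [eq_sum_stdVec a, map_sum]
  simp [pderiv]

/-- The chain rule for the Laplace-Beltrami operator. -/
theorem lap_comp_eq_sum (g : RMetric m M) {n : ℕ} {φ : M → EuclideanSpace ℝ (Fin n)}
    {f : EuclideanSpace ℝ (Fin n) → ℝ} {x : M} (hf : ContDiffAt ℝ 2 f (φ x))
    (hφ : ContMDiffAt (𝓡 m) 𝓘(ℝ, EuclideanSpace ℝ (Fin n)) ∞ φ x) :
    lap g (f ∘ φ) x = ∑ α, pderiv α f (φ x) * lap g (fun z => φ z α) x +
      ∑ α, ∑ β, pderiv α (pderiv β f) (φ x) *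
        gradInner g (fun z => φ z α) (fun z => φ z β) x := by
  rw [lap_comp g hf hφ, fderiv_eq_sum]
  congr 1
  · refine Finset.sum_congr rfl fun α _ => ?_
    have := lap_clm g (EuclideanSpace.proj (𝕜 := ℝ) α) hφ
    rw [mul_comm]
    congr 1
    exact this.symm
  · have hd : DifferentiableAt ℝ (φ ∘ (chartAt (EuclideanSpace ℝ (Fin m)) x).symm)
        (chartAt (EuclideanSpace ℝ (Fin m)) x x) :=
      (contMDiffAt_iff_chart.1 hφ).2.differentiableAt (by simp)
    have hc : ∀ i α, (pderiv i (φ ∘ (chartAt (EuclideanSpace ℝ (Fin m)) x).symm)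
        (chartAt (EuclideanSpace ℝ (Fin m)) x x)) α =
        pderiv i ((fun z => φ z α) ∘ (chartAt (EuclideanSpace ℝ (Fin m)) x).symm)
        (chartAt (EuclideanSpace ℝ (Fin m)) x x) := fun i α =>
      (pderiv_clm (EuclideanSpace.proj (𝕜 := ℝ) α) hd i).symm
    have hm : ∀ α, MDifferentiableAt (𝓡 m) 𝓘(ℝ, ℝ) (fun z => φ z α) x := fun α =>
      (contMDiffAt_coord hφ α).mdifferentiableAt (by simp)
    simp only [fderiv_fderiv_eq_sum hf, gradInner_eq_sum g (hm _) (hm _), hc, smul_eq_mul,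
      Finset.mul_sum]
    calc _ = ∑ i, ∑ α, ∑ j, ∑ β, _ := Finset.sum_congr rfl fun i _ => Finset.sum_comm
      _ = ∑ α, ∑ i, ∑ j, ∑ β, _ := Finset.sum_comm
      _ = ∑ α, ∑ i, ∑ β, ∑ j, _ := Finset.sum_congr rfl fun α _ =>
        Finset.sum_congr rfl fun i _ => Finset.sum_comm
      _ = ∑ α, ∑ β, ∑ i, ∑ j, _ := Finset.sum_congr rfl fun α _ => Finset.sum_comm
      _ = _ := by
        refine Finset.sum_congr rfl fun α _ => Finset.sum_congr rfl fun β _ =>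
          Finset.sum_congr rfl fun i _ => Finset.sum_congr rfl fun j _ => ?_
        ring

theorem gradInner_eq_dmap (g : RMetric m M) (u v : M → ℝ) (x : M) :
    gradInner g u v x = dmap u x (grad g v x) := inner_grad g u x _

theorem gradInner_comm (g : RMetric m M) (u v : M → ℝ) (x : M) :
    gradInner g u v x = gradInner g v u x := g.symm _ _ _

theorem gradInner_comp (g : RMetric m M) {n : ℕ} {φ : M → EuclideanSpace ℝ (Fin n)}
    {f : EuclideanSpace ℝ (Fin n) → ℝ} {x : M} (hf : DifferentiableAt ℝ f (φ x))
    (hφ : MDifferentiableAt (𝓡 m) 𝓘(ℝ, EuclideanSpace ℝ (Fin n)) φ x) (v : M → ℝ) :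
    gradInner g (f ∘ φ) v x = ∑ α, pderiv α f (φ x) * gradInner g (fun z => φ z α) v x := by
  simp only [gradInner_eq_dmap, dmap_coord hφ]
  rw [dmap_comp hf hφ, fderiv_eq_sum]
  exact Finset.sum_congr rfl fun α _ => mul_comm _ _

end Rules

section Product

variable {m : ℕ} {M : Type*} [TopologicalSpace M]
  [ChartedSpace (EuclideanSpace ℝ (Fin m)) M] [IsManifold (𝓡 m) ∞ M]

theorem fderiv_mul_fst_snd (p a : ℝ × ℝ) :
    fderiv ℝ (fun q : ℝ × ℝ => q.1 * q.2) p a = p.1 * a.2 + p.2 * a.1 := by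
  rw [fderiv_fun_mul differentiableAt_fst differentiableAt_snd, fderiv_fst, fderiv_snd]
  simp

theorem fderiv_fderiv_mul_fst_snd (p a b : ℝ × ℝ) :
    fderiv ℝ (fderiv ℝ (fun q : ℝ × ℝ => q.1 * q.2)) p a b = a.1 * b.2 + a.2 * b.1 := by
  have h : DifferentiableAt ℝ (fderiv ℝ (fun q : ℝ × ℝ => q.1 * q.2)) p :=
    ((contDiff_fst.mul contDiff_snd).contDiffAt.fderiv_right (n := 2) (m := 1)
      (by norm_num)).differentiableAt (by norm_num)
  have h1 : fderiv ℝ (fun r => fderiv ℝ (fun q : ℝ × ℝ => q.1 * q.2) r b) p a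
      = fderiv ℝ (fderiv ℝ (fun q : ℝ × ℝ => q.1 * q.2)) p a b := by
    rw [fderiv_clm_apply h (by fun_prop)]
    simp
  have h2 : (fun r : ℝ × ℝ => r.1 * b.2 + r.2 * b.1) =
      ⇑(b.2 • ContinuousLinearMap.fst ℝ ℝ ℝ + b.1 • ContinuousLinearMap.snd ℝ ℝ ℝ) := by
    ext r; simp [mul_comm]
  simp only [fderiv_mul_fst_snd] at h1
  rw [← h1, h2, ContinuousLinearMap.fderiv]
  simp [mul_comm]

/-- Product rule for the Laplace-Beltrami operator. -/
theorem lap_mul (g : RMetric m M) {u v : M → ℝ} {x : M}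
    (hu : ContMDiffAt (𝓡 m) 𝓘(ℝ, ℝ) ∞ u x) (hv : ContMDiffAt (𝓡 m) 𝓘(ℝ, ℝ) ∞ v x) :
    lap g (fun z => u z * v z) x
      = u x * lap g v x + v x * lap g u x + 2 * gradInner g u v x := by
  have huv : ContMDiffAt (𝓡 m) 𝓘(ℝ, ℝ × ℝ) ∞ (fun z => (u z, v z)) x := hu.prodMk_space hv
  have h := lap_comp g (u := fun z => (u z, v z)) (f := fun q : ℝ × ℝ => q.1 * q.2) (x := x)
    (contDiff_fst.mul contDiff_snd).contDiffAt huv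
  have hd : DifferentiableAt ℝ ((fun z => (u z, v z)) ∘ (chartAt (EuclideanSpace ℝ (Fin m)) x).symm)
      (chartAt (EuclideanSpace ℝ (Fin m)) x x) :=
    (contMDiffAt_iff_chart.1 huv).2.differentiableAt (by simp)
  have h1 : (lap g (fun z => (u z, v z)) x).1 = lap g u x :=
    (lap_clm g (ContinuousLinearMap.fst ℝ ℝ ℝ) huv).symm
  have h2 : (lap g (fun z => (u z, v z)) x).2 = lap g v x :=
    (lap_clm g (ContinuousLinearMap.snd ℝ ℝ ℝ) huv).symm
  have h3 := fun i => (pderiv_clm (ContinuousLinearMap.fst ℝ ℝ ℝ) hd i).symm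
  have h4 := fun i => (pderiv_clm (ContinuousLinearMap.snd ℝ ℝ ℝ) hd i).symm
  simp only [ContinuousLinearMap.coe_fst', ContinuousLinearMap.coe_snd'] at h3 h4
  rw [fderiv_mul_fst_snd] at h
  simp only [fderiv_fderiv_mul_fst_snd, h1, h2, h3, h4] at h
  refine h.trans ?_
  rw [two_mul]
  nth_rewrite 2 [gradInner_comm]
  rw [gradInner_eq_sum g (hu.mdifferentiableAt (by simp)) (hv.mdifferentiableAt (by simp)),
    gradInner_eq_sum g (hv.mdifferentiableAt (by simp)) (hu.mdifferentiableAt (by simp))]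
  simp only [smul_eq_mul, mul_add, Finset.sum_add_distrib]
  rfl

theorem lap_linear (g : RMetric m M) {u v : M → ℝ} {x : M} (a b : ℝ)
    (hu : ContMDiffAt (𝓡 m) 𝓘(ℝ, ℝ) ∞ u x) (hv : ContMDiffAt (𝓡 m) 𝓘(ℝ, ℝ) ∞ v x) :
    lap g (fun z => a * u z + b * v z) x = a * lap g u x + b * lap g v x := by
  have huv : ContMDiffAt (𝓡 m) 𝓘(ℝ, ℝ × ℝ) ∞ (fun z => (u z, v z)) x := hu.prodMk_space hv
  have h := lap_clm g (a • ContinuousLinearMap.fst ℝ ℝ ℝ + b • ContinuousLinearMap.snd ℝ ℝ ℝ) huv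
  have h1 := lap_clm g (ContinuousLinearMap.fst ℝ ℝ ℝ) huv
  have h2 := lap_clm g (ContinuousLinearMap.snd ℝ ℝ ℝ) huv
  simp at h h1 h2
  rw [h, h1, h2]

theorem lap_add (g : RMetric m M) {u v : M → ℝ} {x : M}
    (hu : ContMDiffAt (𝓡 m) 𝓘(ℝ, ℝ) ∞ u x) (hv : ContMDiffAt (𝓡 m) 𝓘(ℝ, ℝ) ∞ v x) :
    lap g (fun z => u z + v z) x = lap g u x + lap g v x := by
  simpa using lap_linear g 1 1 hu hv

theorem lap_const (g : RMetric m M) (c : ℝ) (x : M) : lap g (fun _ => c) x = 0 := by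
  have h := lap_comp g (u := fun _ : M => (0 : ℝ)) (f := fun _ : ℝ => c) (x := x)
    contDiffAt_const contMDiffAt_const
  refine h.trans ?_
  simp

theorem lap_sum (g : RMetric m M) {ι : Type*} (s : Finset ι) {u : ι → M → ℝ} {x : M}
    (hu : ∀ i ∈ s, ContMDiffAt (𝓡 m) 𝓘(ℝ, ℝ) ∞ (u i) x) :
    lap g (fun z => ∑ i ∈ s, u i z) x = ∑ i ∈ s, lap g (u i) x := by
  classical
  induction s using Finset.induction_on with
  | empty => simpa using lap_const g 0 x
  | insert a s ha ih =>
    simp only [Finset.sum_insert ha]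
    rw [lap_add g (hu a (Finset.mem_insert_self _ _))
      (contMDiffAt_finsetSum fun i hi => hu i (Finset.mem_insert_of_mem hi)),
      ih fun i hi => hu i (Finset.mem_insert_of_mem hi)]

theorem gradInner_mul (g : RMetric m M) {u v : M → ℝ} {x : M}
    (hu : ContMDiffAt (𝓡 m) 𝓘(ℝ, ℝ) ∞ u x) (hv : ContMDiffAt (𝓡 m) 𝓘(ℝ, ℝ) ∞ v x) (w : M → ℝ) :
    gradInner g (fun z => u z * v z) w x
      = u x * gradInner g v w x + v x * gradInner g u w x := by
  have huv : MDifferentiableAt (𝓡 m) 𝓘(ℝ, ℝ × ℝ) (fun z => (u z, v z)) x :=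
    (hu.prodMk_space hv).mdifferentiableAt (by simp)
  have h := dmap_comp (f := fun q : ℝ × ℝ => q.1 * q.2) (by fun_prop) huv (grad g w x)
  have h1 := dmap_comp (f := fun q : ℝ × ℝ => q.1) (by fun_prop) huv (grad g w x)
  have h2 := dmap_comp (f := fun q : ℝ × ℝ => q.2) (by fun_prop) huv (grad g w x)
  rw [fderiv_mul_fst_snd] at h
  rw [fderiv_fst] at h1
  rw [fderiv_snd] at h2
  simp only [gradInner_eq_dmap]
  refine h.trans ?_
  exact congrArg₂ (fun a b => u x * a + v x * b) h2.symm h1.symm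

theorem _root_.ContMDiffAt.gradInner (g : RMetric m M) {u v : M → ℝ} {x : M}
    (hu : ContMDiffAt (𝓡 m) 𝓘(ℝ, ℝ) ∞ u x) (hv : ContMDiffAt (𝓡 m) 𝓘(ℝ, ℝ) ∞ v x)
    (hu' : ∀ᶠ z in nhds x, ContMDiffAt (𝓡 m) 𝓘(ℝ, ℝ) ∞ u z)
    (hv' : ∀ᶠ z in nhds x, ContMDiffAt (𝓡 m) 𝓘(ℝ, ℝ) ∞ v z) :
    ContMDiffAt (𝓡 m) 𝓘(ℝ, ℝ) ∞ (gradInner g u v) x := by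
  have h : ContMDiffAt (𝓡 m) 𝓘(ℝ, ℝ) ∞ (fun z => (1 / 2 : ℝ) *
      (lap g (fun z => u z * v z) z - (u z * lap g v z + v z * lap g u z))) x :=
    contMDiffAt_const.mul (((hu.mul hv).lap g).sub ((hu.mul (hv.lap g)).add (hv.mul (hu.lap g))))
  refine h.congr_of_eventuallyEq ?_
  filter_upwards [hu', hv'] with z h1 h2
  rw [lap_mul g h1 h2]
  ring

end Product

section EuclideanLaplacian

variable {n : ℕ} {F : Type*} [NormedAddCommGroup F] [NormedSpace ℝ F]

theorem laplacian_eq_sum_pderiv {f : EuclideanSpace ℝ (Fin n) → F} {p : EuclideanSpace ℝ (Fin n)}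
    (hf : ContDiffAt ℝ 2 f p) : (Δ f) p = ∑ i, pderiv i (pderiv i f) p := by
  rw [InnerProductSpace.laplacian_eq_iteratedFDeriv_orthonormalBasis f
    (EuclideanSpace.basisFun (Fin n) ℝ)]
  refine Finset.sum_congr rfl fun i _ => ?_
  rw [pderiv_pderiv hf, iteratedFDeriv_two_apply]
  simp

theorem laplacian_eventually_eq {f : EuclideanSpace ℝ (Fin n) → F} {p : EuclideanSpace ℝ (Fin n)}
    (hf : ContDiffAt ℝ ∞ f p) : Δ f =ᶠ[nhds p] fun q => ∑ i, pderiv i (pderiv i f) q :=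
  ((hf.of_le two_le_infty).eventually (by simp)).mono fun _ hq => laplacian_eq_sum_pderiv hq

theorem _root_.ContDiffAt.laplacian_infty {f : EuclideanSpace ℝ (Fin n) → F}
    {p : EuclideanSpace ℝ (Fin n)} (hf : ContDiffAt ℝ ∞ f p) : ContDiffAt ℝ ∞ (Δ f) p :=
  (ContDiffAt.sum fun i _ => (hf.pderiv i).pderiv i).congr_of_eventuallyEq
    (laplacian_eventually_eq hf)

theorem pderiv_comm {f : EuclideanSpace ℝ (Fin n) → F} {p : EuclideanSpace ℝ (Fin n)}
    (hf : ContDiffAt ℝ 2 f p) (i j : Fin n) :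
    pderiv i (pderiv j f) p = pderiv j (pderiv i f) p := by
  rw [pderiv_pderiv hf, pderiv_pderiv hf]
  exact (hf.isSymmSndFDerivAt (by simp)).eq _ _

theorem pderiv_sum {ι : Type*} (s : Finset ι) {f : ι → EuclideanSpace ℝ (Fin n) → F}
    {p : EuclideanSpace ℝ (Fin n)} (hf : ∀ i ∈ s, DifferentiableAt ℝ (f i) p) (j : Fin n) :
    pderiv j (fun q => ∑ i ∈ s, f i q) p = ∑ i ∈ s, pderiv j (f i) p := by
  rw [pderiv, fderiv_fun_sum hf]
  simp [pderiv]

theorem laplacian_pderiv {f : EuclideanSpace ℝ (Fin n) → F} {p : EuclideanSpace ℝ (Fin n)}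
    (hf : ContDiffAt ℝ ∞ f p) (α : Fin n) : (Δ (pderiv α f)) p = pderiv α (Δ f) p := by
  rw [laplacian_eq_sum_pderiv ((hf.pderiv α).of_le two_le_infty),
    (pderiv_congr (laplacian_eventually_eq hf) α).self_of_nhds,
    pderiv_sum _ fun i _ => ((hf.pderiv i).pderiv i).differentiableAt (by simp)]
  refine Finset.sum_congr rfl fun i _ => ?_
  rw [pderiv_comm ((hf.pderiv i).of_le two_le_infty) α i]
  have : pderiv i (pderiv α f) =ᶠ[nhds p] pderiv α (pderiv i f) :=
    ((hf.of_le two_le_infty).eventually (by simp)).mono fun _ hq => pderiv_comm hq i α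
  exact (pderiv_congr this i).self_of_nhds

/-- The complex coordinate `yα + i yβ`. -/
def complexCoord (α β : Fin n) : EuclideanSpace ℝ (Fin n) →L[ℝ] ℂ :=
  Complex.ofRealCLM.comp (EuclideanSpace.proj α)
    + Complex.I • Complex.ofRealCLM.comp (EuclideanSpace.proj β)

theorem complexCoord_apply (α β : Fin n) (y : EuclideanSpace ℝ (Fin n)) :
    complexCoord α β y = (y α : ℂ) + Complex.I * (y β : ℂ) := by
  simp [complexCoord]

theorem contDiff_complexCoord_pow (α β : Fin n) (c : EuclideanSpace ℝ (Fin n)) (k : ℕ) (a : ℂ) :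
    ContDiff ℝ ∞ (fun y => a * complexCoord α β (y - c) ^ k) :=
  contDiff_const.mul (((complexCoord α β).contDiff.comp (contDiff_id.sub contDiff_const)).pow k)

theorem pderiv_complexCoord_pow (α β : Fin n) (c : EuclideanSpace ℝ (Fin n)) (k : ℕ) (a : ℂ)
    (i : Fin n) : pderiv i (fun y => a * complexCoord α β (y - c) ^ k) = fun y =>
      (a * k * complexCoord α β (stdVec i)) * complexCoord α β (y - c) ^ (k - 1) := by
  funext y
  have h : HasFDerivAt (fun y => complexCoord α β (y - c)) (complexCoord α β) y := by
    exact (complexCoord α β).hasFDerivAt.comp y ((hasFDerivAt_id y).sub_const c)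
  rw [pderiv, ((h.pow k).const_mul a).fderiv]
  simp
  ring

theorem laplacian_complexCoord_pow {α β : Fin n} (hαβ : α ≠ β) (c : EuclideanSpace ℝ (Fin n))
    (k : ℕ) : Δ (fun y => complexCoord α β (y - c) ^ k) = 0 := by
  funext y
  have h := contDiff_complexCoord_pow α β c k 1
  simp only [one_mul] at h
  rw [laplacian_eq_sum_pderiv (h.contDiffAt.of_le two_le_infty)]
  have h1 := fun i => pderiv_complexCoord_pow α β c k 1 i
  simp only [one_mul] at h1
  simp only [h1, pderiv_complexCoord_pow]
  have h2 : ∑ i, complexCoord α β (stdVec i) ^ 2 = 0 := by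
    have : ∀ i, complexCoord α β (stdVec i) ^ 2
        = (if α = i then 1 else 0) - (if β = i then 1 else 0) := by
      intro i
      rw [complexCoord_apply]
      by_cases h : α = i <;> by_cases h' : β = i
      · exact absurd (h.trans h'.symm) hαβ
      all_goals simp [h, h']
    simp [this]
  calc _ = ∑ i, complexCoord α β (stdVec i) ^ 2 *
        (k * (k - 1 : ℕ) * complexCoord α β (y - c) ^ (k - 1 - 1)) :=
        Finset.sum_congr rfl fun i _ => by ring
    _ = _ := by rw [← Finset.sum_mul, h2]; simp

theorem harmonic_clm_complexCoord_pow {α β : Fin n} (hαβ : α ≠ β) (c : EuclideanSpace ℝ (Fin n))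
    (k : ℕ) (ℓ : ℂ →L[ℝ] ℝ) (U : Set (EuclideanSpace ℝ (Fin n))) :
    ContDiff ℝ ∞ (fun y => ℓ (complexCoord α β (y - c) ^ k)) ∧
    InnerProductSpace.HarmonicOnNhd (fun y => ℓ (complexCoord α β (y - c) ^ k)) U := by
  have h := contDiff_complexCoord_pow α β c k 1
  simp only [one_mul] at h
  refine ⟨ℓ.contDiff.comp h, fun x _ => ⟨(ℓ.contDiff.comp h).contDiffAt.of_le two_le_infty,
    Filter.Eventually.of_forall fun y => ?_⟩⟩
  have := ContDiffAt.laplacian_CLM_comp_left (l := ℓ) (h.contDiffAt (x := y) |>.of_le two_le_infty)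
  refine this.trans ?_
  rw [laplacian_complexCoord_pow hαβ]
  simp

theorem harmonic_coord (α : Fin n) (U : Set (EuclideanSpace ℝ (Fin n))) :
    InnerProductSpace.HarmonicOnNhd (fun y : EuclideanSpace ℝ (Fin n) => y α) U := by
  have hc : ContDiff ℝ 2 (fun y : EuclideanSpace ℝ (Fin n) => y α) :=
    (EuclideanSpace.proj (𝕜 := ℝ) α).contDiff
  refine fun x _ => ⟨hc.contDiffAt, Filter.Eventually.of_forall fun y => ?_⟩
  rw [laplacian_eq_sum_pderiv hc.contDiffAt]
  have h : ∀ i, pderiv i (fun y : EuclideanSpace ℝ (Fin n) => y α)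
      = fun _ => (stdVec i : EuclideanSpace ℝ (Fin n)) α := fun i => funext fun y => by
    have := (EuclideanSpace.proj (𝕜 := ℝ) α).fderiv (x := y)
    exact congrArg (fun D : EuclideanSpace ℝ (Fin n) →L[ℝ] ℝ => D (stdVec i)) this
  simp [h, pderiv]

end EuclideanLaplacian

section Conformality

variable {m n : ℕ} {M : Type*} [TopologicalSpace M]
  [ChartedSpace (EuclideanSpace ℝ (Fin m)) M] [IsManifold (𝓡 m) ∞ M]

theorem gradInner_self_nonneg (g : RMetric m M) (u : M → ℝ) (x : M) : 0 ≤ gradInner g u u x := by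
  by_cases hg : grad g u x = 0
  · rw [gradInner, hg]; simp
  · exact (g.pos x _ hg).le

theorem dmap_eq_zero_of_gradInner_self (g : RMetric m M) {u : M → ℝ} {x : M}
    (h : gradInner g u u x = 0) (V : TangentSpace (𝓡 m) x) : dmap u x V = 0 := by
  have h0 : grad g u x = 0 := by
    by_contra h0
    exact (g.pos x _ h0).ne' h
  rw [← inner_grad g u x V, h0]
  simp

/-- Horizontal weak conformality in terms of the Gram matrix of the gradients. -/
theorem horizontallyWeaklyConformal_iff (g : RMetric m M) {φ : M → EuclideanSpace ℝ (Fin n)}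
    (hφ : MDifferentiable (𝓡 m) 𝓘(ℝ, EuclideanSpace ℝ (Fin n)) φ) :
    HorizontallyWeaklyConformal g φ ↔ ∀ x, ∃ s : ℝ, ∀ α β,
      gradInner g (fun z => φ z α) (fun z => φ z β) x = if α = β then s else 0 := by
  refine forall_congr' fun x => ?_
  have hd : ∀ α V, dmap (fun z => φ z α) x V = (dmap φ x V : EuclideanSpace ℝ (Fin n)) α :=
    fun α V => dmap_coord (hφ x) α V
  have hcoord : ∀ α β, gradInner g (fun z => φ z α) (fun z => φ z β) x
      = (dmap φ x (grad g (fun z => φ z β) x) : EuclideanSpace ℝ (Fin n)) α := fun α β => by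
    rw [gradInner_eq_dmap, hd]
  have hhor : ∀ α, Horizontal g φ x (grad g (fun z => φ z α) x) := fun α V hV => by
    rw [inner_grad, hd, hV]; rfl
  constructor
  · rintro (h0 | ⟨hsurj, lam, hlam, hconf⟩)
    · refine ⟨0, fun α β => ?_⟩
      rw [hcoord, h0]
      simp
    · refine ⟨lam ^ 2, fun α β => ?_⟩
      set N : TangentSpace (𝓡 m) x := grad g (fun z => φ z β) x with hN
      -- the covector dual to `c` vanishes as soon as its gradient does
      have hinj : ∀ c : EuclideanSpace ℝ (Fin n),
          (∀ α, ∑ γ, c γ * gradInner g (fun z => φ z γ) (fun z => φ z α) x = 0) → c = 0 := by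
        intro c hc
        set X : TangentSpace (𝓡 m) x := ∑ γ, c γ • grad g (fun z => φ z γ) x with hX
        have hXV : ∀ V, g.inner x X V = ∑ γ, c γ * dmap (fun z => φ z γ) x V := by
          intro V
          rw [hX, map_sum]
          simp only [map_smul, sum_apply, smul_apply, inner_grad, smul_eq_mul]
        have hX0 : X = 0 := by
          by_contra hne
          refine (g.pos x X hne).ne' ?_
          conv_lhs => rw [hX]
          rw [g.symm, map_sum]
          refine Finset.sum_eq_zero fun α _ => ?_
          rw [map_smul, hXV, smul_eq_mul]
          have := hc α
          simp only [gradInner_eq_dmap] at this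
          rw [this, mul_zero]
        obtain ⟨V, hV⟩ := hsurj c
        have h1 := hXV V
        rw [hX0] at h1
        simp only [hd, hV, map_zero, zero_apply] at h1
        ext γ
        have h2 := (Finset.sum_eq_zero_iff_of_nonneg (fun γ _ => mul_self_nonneg (c γ))).1 h1.symm
        simpa using h2 γ (Finset.mem_univ _)
      have key : (dmap φ x N : EuclideanSpace ℝ (Fin n)) - lam ^ 2 • stdVec β = 0 := by
        apply hinj
        intro α
        have h1 := hconf N (grad g (fun z => φ z α) x) (hhor β) (hhor α)
        rw [inner_grad, hd, PiLp.inner_apply] at h1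
        simp only [hcoord]
        simp only [PiLp.sub_apply, PiLp.smul_apply, sub_mul, Finset.sum_sub_distrib]
        rw [sub_eq_zero]
        refine Eq.trans ?_ (h1.trans ?_)
        · exact Finset.sum_congr rfl fun γ _ => by simp [mul_comm]
        · simp
      rw [hcoord, sub_eq_zero.1 key]
      simp
  · rintro ⟨s, hs⟩
    by_cases h0 : 0 < s
    · right
      have hdN : ∀ β, dmap φ x (grad g (fun z => φ z β) x) = s • stdVec β := by
        intro β
        ext α
        rw [← hcoord, hs]
        simp
      have hlift : ∀ c : EuclideanSpace ℝ (Fin n),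
          dmap φ x (∑ γ, (s⁻¹ * c γ) • grad g (fun z => φ z γ) x) = c := by
        intro c
        rw [map_sum]
        conv_rhs => rw [eq_sum_stdVec c]
        refine Finset.sum_congr rfl fun γ _ => ?_
        rw [map_smul, hdN, smul_smul, mul_right_comm, inv_mul_cancel₀ h0.ne', one_mul]
      refine ⟨fun c => ⟨_, hlift c⟩, Real.sqrt s, Real.sqrt_pos.2 h0, fun X Y hX _ => ?_⟩
      rw [Real.sq_sqrt h0.le]
      have h1 := hX (Y - ∑ γ, (s⁻¹ * (dmap φ x Y : EuclideanSpace ℝ (Fin n)) γ) •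
        grad g (fun z => φ z γ) x) (by rw [map_sub, hlift, sub_self])
      rw [map_sub, sub_eq_zero, map_sum] at h1
      rw [h1, Finset.mul_sum, PiLp.inner_apply]
      refine Finset.sum_congr rfl fun γ _ => ?_
      rw [map_smul, g.symm, inner_grad, hd, smul_eq_mul]
      simp only [RCLike.inner_apply, conj_trivial]
      field_simp
    · left
      refine ContinuousLinearMap.ext fun V => ?_
      ext α
      rw [← hd]
      refine dmap_eq_zero_of_gradInner_self g (le_antisymm ?_ ?_) V
      · rw [hs, if_pos rfl]
        exact not_lt.1 h0
      · exact gradInner_self_nonneg g _ x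

end Conformality

section Smooth

variable {m : ℕ} {M : Type*} [TopologicalSpace M] [ChartedSpace (EuclideanSpace ℝ (Fin m)) M]

theorem _root_.ContMDiffAt.mul_real {u v : M → ℝ} {x : M}
    (hu : ContMDiffAt (𝓡 m) 𝓘(ℝ, ℝ) ∞ u x) (hv : ContMDiffAt (𝓡 m) 𝓘(ℝ, ℝ) ∞ v x) :
    ContMDiffAt (𝓡 m) 𝓘(ℝ, ℝ) ∞ (fun z => u z * v z) x := hu.mul hv

theorem _root_.ContMDiff.mul_real {u v : M → ℝ} (hu : ContMDiff (𝓡 m) 𝓘(ℝ, ℝ) ∞ u)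
    (hv : ContMDiff (𝓡 m) 𝓘(ℝ, ℝ) ∞ v) :
    ContMDiff (𝓡 m) 𝓘(ℝ, ℝ) ∞ (fun z => u z * v z) := hu.mul hv

theorem _root_.ContMDiff.add_real {u v : M → ℝ} (hu : ContMDiff (𝓡 m) 𝓘(ℝ, ℝ) ∞ u)
    (hv : ContMDiff (𝓡 m) 𝓘(ℝ, ℝ) ∞ v) :
    ContMDiff (𝓡 m) 𝓘(ℝ, ℝ) ∞ (fun z => u z + v z) := hu.add hv

end Smooth

section Bilaplacian

variable {m n : ℕ} {M : Type*} [TopologicalSpace M]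
  [ChartedSpace (EuclideanSpace ℝ (Fin m)) M] [IsManifold (𝓡 m) ∞ M]

theorem _root_.ContMDiff.lap {F : Type*} [NormedAddCommGroup F] [NormedSpace ℝ F]
    (g : RMetric m M) {u : M → F} (hu : ContMDiff (𝓡 m) 𝓘(ℝ, F) ∞ u) :
    ContMDiff (𝓡 m) 𝓘(ℝ, F) ∞ (lap g u) := fun x => (hu x).lap g

theorem _root_.ContMDiff.gradInner (g : RMetric m M) {u v : M → ℝ}
    (hu : ContMDiff (𝓡 m) 𝓘(ℝ, ℝ) ∞ u) (hv : ContMDiff (𝓡 m) 𝓘(ℝ, ℝ) ∞ v) :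
    ContMDiff (𝓡 m) 𝓘(ℝ, ℝ) ∞ (gradInner g u v) := fun x =>
  (hu x).gradInner g (hv x) (Filter.Eventually.of_forall hu) (Filter.Eventually.of_forall hv)

theorem lap_lap_clm {F F' : Type*} [NormedAddCommGroup F] [NormedSpace ℝ F]
    [NormedAddCommGroup F'] [NormedSpace ℝ F'] (g : RMetric m M) (ℓ : F →L[ℝ] F') {u : M → F}
    (hu : ContMDiff (𝓡 m) 𝓘(ℝ, F) ∞ u) (x : M) :
    lap g (lap g fun z => ℓ (u z)) x = ℓ (lap g (lap g u) x) := by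
  rw [show (lap g fun z => ℓ (u z)) = fun z => ℓ (lap g u z) from
    funext fun z => lap_clm g ℓ (hu z), lap_clm g ℓ (hu.lap g x)]

theorem lap_lap_linear (g : RMetric m M) {u v : M → ℝ} (a b : ℝ)
    (hu : ContMDiff (𝓡 m) 𝓘(ℝ, ℝ) ∞ u) (hv : ContMDiff (𝓡 m) 𝓘(ℝ, ℝ) ∞ v) (x : M) :
    lap g (lap g fun z => a * u z + b * v z) x
      = a * lap g (lap g u) x + b * lap g (lap g v) x := by
  rw [show (lap g fun z => a * u z + b * v z) = fun z => a * lap g u z + b * lap g v z from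
    funext fun z => lap_linear g a b (hu z) (hv z), lap_linear g a b (hu.lap g x) (hv.lap g x)]

theorem lap_lap_mul (g : RMetric m M) {u v : M → ℝ}
    (hu : ContMDiff (𝓡 m) 𝓘(ℝ, ℝ) ∞ u) (hv : ContMDiff (𝓡 m) 𝓘(ℝ, ℝ) ∞ v) (x : M) :
    lap g (lap g fun z => u z * v z) x
      = u x * lap g (lap g v) x + v x * lap g (lap g u) x
        + 2 * (lap g u x * lap g v x + gradInner g u (lap g v) x + gradInner g v (lap g u) x
          + lap g (gradInner g u v) x) := by
  have h1 := (hu.mul_real (hv.lap g))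
  have h2 := (hv.mul_real (hu.lap g))
  rw [show (lap g fun z => u z * v z) = fun z => u z * lap g v z + v z * lap g u z
      + 2 * gradInner g u v z from funext fun z => lap_mul g (hu z) (hv z),
    lap_add g ((h1.add_real h2) x) ((contMDiff_const.mul_real (hu.gradInner g hv)) x),
    lap_add g (h1 x) (h2 x), lap_mul g (hu x) (hv.lap g x), lap_mul g (hv x) (hu.lap g x),
    show lap g (fun z => 2 * gradInner g u v z) x = 2 * lap g (gradInner g u v) x by
      simpa using lap_linear g 2 0 (hu.gradInner g hv x) (hu.gradInner g hv x)]
  ring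

/-- The bilaplacian of a product of four functions at a common zero. -/
theorem lap_lap_mul_four (g : RMetric m M) {u v w t : M → ℝ}
    (hu : ContMDiff (𝓡 m) 𝓘(ℝ, ℝ) ∞ u) (hv : ContMDiff (𝓡 m) 𝓘(ℝ, ℝ) ∞ v)
    (hw : ContMDiff (𝓡 m) 𝓘(ℝ, ℝ) ∞ w) (ht : ContMDiff (𝓡 m) 𝓘(ℝ, ℝ) ∞ t) {x : M}
    (hux : u x = 0) (hvx : v x = 0) (hwx : w x = 0) (htx : t x = 0) :
    lap g (lap g fun z => (u z * v z) * (w z * t z)) x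
      = 8 * (gradInner g u v x * gradInner g w t x + gradInner g u w x * gradInner g v t x
        + gradInner g u t x * gradInner g v w x) := by
  have hprod : ∀ {a b c : M → ℝ}, ContMDiff (𝓡 m) 𝓘(ℝ, ℝ) ∞ a → ContMDiff (𝓡 m) 𝓘(ℝ, ℝ) ∞ b →
      ContMDiff (𝓡 m) 𝓘(ℝ, ℝ) ∞ c → a x = 0 → b x = 0 →
      lap g (fun z => (a z * b z) * c z) x = 2 * gradInner g a b x * c x := by
    intro a b c ha hb hc hax hbx
    rw [lap_mul g (u := fun z => a z * b z) ((ha.mul_real hb) x) (hc x), lap_mul g (ha x) (hb x),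
      gradInner_mul g (ha x) (hb x), hax, hbx]
    ring
  have hG : gradInner g (fun z => u z * v z) (fun z => w z * t z) = fun z =>
      ((u z * w z) * gradInner g v t z + (u z * t z) * gradInner g v w z)
        + ((v z * w z) * gradInner g u t z + (v z * t z) * gradInner g u w z) := by
    funext z
    rw [gradInner_mul g (hu z) (hv z), gradInner_comm g v, gradInner_comm g u,
      gradInner_mul g (hw z) (ht z), gradInner_mul g (hw z) (ht z), gradInner_comm g t,
      gradInner_comm g w, gradInner_comm g t, gradInner_comm g w]
    ring
  have s1 := (hu.mul_real hw).mul_real (hv.gradInner g ht)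
  have s2 := (hu.mul_real ht).mul_real (hv.gradInner g hw)
  have s3 := (hv.mul_real hw).mul_real (hu.gradInner g ht)
  have s4 := (hv.mul_real ht).mul_real (hu.gradInner g hw)
  rw [lap_lap_mul g (hu.mul_real hv) (hw.mul_real ht), hG,
    lap_add g ((s1.add_real s2) x) ((s3.add_real s4) x), lap_add g (s1 x) (s2 x), lap_add g (s3 x) (s4 x),
    hprod hu hw (hv.gradInner g ht) hux hwx, hprod hu ht (hv.gradInner g hw) hux htx,
    hprod hv hw (hu.gradInner g ht) hvx hwx, hprod hv ht (hu.gradInner g hw) hvx htx,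
    gradInner_mul g (hu x) (hv x), gradInner_mul g (hw x) (ht x), lap_mul g (hu x) (hv x),
    lap_mul g (hw x) (ht x), hux, hvx, hwx, htx]
  ring

/-- The bilaplacian of a composition with a map the gradients of whose components are
orthogonal and of the same length. -/
theorem lap_lap_comp (g : RMetric m M) {φ : M → EuclideanSpace ℝ (Fin n)}
    (hφ : ContMDiff (𝓡 m) 𝓘(ℝ, EuclideanSpace ℝ (Fin n)) ∞ φ) {s : M → ℝ}
    (hs : ContMDiff (𝓡 m) 𝓘(ℝ, ℝ) ∞ s)
    (hg : ∀ z α β, gradInner g (fun z => φ z α) (fun z => φ z β) z = if α = β then s z else 0)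
    {x : M} (hbi : ∀ α, lap g (lap g fun z => φ z α) x = 0) {b : ℝ}
    (hb : ∀ α β, lap g (fun z => φ z α) x * lap g (fun z => φ z β) x
      + gradInner g (fun z => φ z α) (lap g fun z => φ z β) x
      + gradInner g (fun z => φ z β) (lap g fun z => φ z α) x = if α = β then b else 0)
    {U : Set (EuclideanSpace ℝ (Fin n))} (hU : IsOpen U) {f : EuclideanSpace ℝ (Fin n) → ℝ}
    (hf : ∀ p ∈ U, ContDiffAt ℝ ∞ f p) (hx : φ x ∈ U) :
    lap g (lap g (f ∘ φ)) x = s x ^ 2 * (Δ (Δ f)) (φ x)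
      + 2 * ∑ α, (s x * lap g (fun z => φ z α) x + gradInner g s (fun z => φ z α) x)
          * pderiv α (Δ f) (φ x)
      + (lap g s x + b) * (Δ f) (φ x) := by
  have hφα : ∀ α, ContMDiff (𝓡 m) 𝓘(ℝ, ℝ) ∞ (fun z => φ z α) := fun α z => contMDiffAt_coord (hφ z) α
  have hlap : ∀ {h : EuclideanSpace ℝ (Fin n) → ℝ} {z : M}, ContDiffAt ℝ ∞ h (φ z) →
      lap g (h ∘ φ) z = s z * (Δ h) (φ z) + ∑ α, pderiv α h (φ z) * lap g (fun z => φ z α) z := by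
    intro h z hh
    rw [lap_comp_eq_sum g (hh.of_le two_le_infty) (hφ z),
      laplacian_eq_sum_pderiv (hh.of_le two_le_infty), Finset.mul_sum, add_comm]
    congr 1
    refine Finset.sum_congr rfl fun α _ => ?_
    simp [hg, mul_comm]
  have hfx := hf _ hx
  have hcomp : ∀ {h : EuclideanSpace ℝ (Fin n) → ℝ}, ContDiffAt ℝ ∞ h (φ x) →
      ContMDiffAt (𝓡 m) 𝓘(ℝ, ℝ) ∞ (h ∘ φ) x := fun hh => hh.contMDiffAt.comp x (hφ x)
  have hV : ∀ᶠ z in nhds x, φ z ∈ U := (hφ.continuous.continuousAt).eventually (hU.mem_nhds hx)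
  have e1 : lap g (f ∘ φ) =ᶠ[nhds x] fun z => s z * (Δ f ∘ φ) z
      + ∑ α, (pderiv α f ∘ φ) z * lap g (fun z => φ z α) z :=
    hV.mono fun z hz => hlap (hf _ hz)
  have hd := hfx.laplacian_infty
  have hp := fun α => hfx.pderiv α
  have hsum : ∀ α ∈ Finset.univ, ContMDiffAt (𝓡 m) 𝓘(ℝ, ℝ) ∞
      (fun z => (pderiv α f ∘ φ) z * lap g (fun z => φ z α) z) x :=
    fun α _ => (hcomp (hp α)).mul_real ((hφα α).lap g x)
  have hsum' : ContMDiffAt (𝓡 m) 𝓘(ℝ, ℝ) ∞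
      (fun z => ∑ α, (pderiv α f ∘ φ) z * lap g (fun z => φ z α) z) x :=
    contMDiffAt_finsetSum hsum
  have hmd := (hφ x).mdifferentiableAt (n := ∞) (by simp)
  rw [lap_congr g e1, lap_add g ((hs x).mul_real (hcomp hd)) hsum',
    lap_mul g (hs x) (hcomp hd), hlap hd, lap_sum g _ hsum, gradInner_comm g s,
    gradInner_comp g (hd.differentiableAt (by simp)) hmd]
  have h1 : ∀ α, lap g (fun z => (pderiv α f ∘ φ) z * lap g (fun z => φ z α) z) x
      = s x * pderiv α (Δ f) (φ x) * lap g (fun z => φ z α) x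
        + ∑ β, pderiv β (pderiv α f) (φ x) * (lap g (fun z => φ z α) x * lap g (fun z => φ z β) x
          + 2 * gradInner g (fun z => φ z β) (lap g fun z => φ z α) x) := by
    intro α
    rw [lap_mul g (hcomp (hp α)) ((hφα α).lap g x), hbi, hlap (hp α), laplacian_pderiv hfx,
      gradInner_comp g ((hp α).differentiableAt (by simp)) hmd]
    simp only [mul_add, Finset.sum_add_distrib, Finset.mul_sum, Function.comp_apply, mul_zero,
      zero_add]
    rw [add_assoc]
    congr 1
    · ring
    · congr 1 <;> exact Finset.sum_congr rfl fun β _ => by ring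
  have h2 : ∑ α, ∑ β, pderiv β (pderiv α f) (φ x) *
        (lap g (fun z => φ z α) x * lap g (fun z => φ z β) x
          + 2 * gradInner g (fun z => φ z β) (lap g fun z => φ z α) x) = b * (Δ f) (φ x) := by
    have h3 : ∑ α, ∑ β, pderiv β (pderiv α f) (φ x) *
          gradInner g (fun z => φ z β) (lap g fun z => φ z α) x = ∑ α, ∑ β,
          pderiv β (pderiv α f) (φ x) *
          gradInner g (fun z => φ z α) (lap g fun z => φ z β) x := by
      rw [Finset.sum_comm]
      refine Finset.sum_congr rfl fun α _ => Finset.sum_congr rfl fun β _ => ?_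
      rw [pderiv_comm (hfx.of_le two_le_infty)]
    calc _ = ∑ α, ∑ β, pderiv β (pderiv α f) (φ x) *
          (lap g (fun z => φ z α) x * lap g (fun z => φ z β) x
          + gradInner g (fun z => φ z α) (lap g fun z => φ z β) x
          + gradInner g (fun z => φ z β) (lap g fun z => φ z α) x) := by
          simp only [mul_add, two_mul, Finset.sum_add_distrib, h3]
          ring
      _ = _ := by
          rw [laplacian_eq_sum_pderiv (hfx.of_le two_le_infty), Finset.mul_sum]
          refine Finset.sum_congr rfl fun α _ => ?_
          simp [hb, mul_comm]
  simp only [h1]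
  rw [Finset.sum_add_distrib, h2]
  simp only [Function.comp_apply, gradInner_comm g s, add_mul, mul_add, Finset.sum_add_distrib,
    Finset.mul_sum]
  have h4 : ∑ α, 2 * (s x * lap g (fun z => φ z α) x * pderiv α (Δ f) (φ x))
      = ∑ α, s x * (pderiv α (Δ f) (φ x) * lap g (fun z => φ z α) x)
        + ∑ α, s x * pderiv α (Δ f) (φ x) * lap g (fun z => φ z α) x := by
    rw [← Finset.sum_add_distrib]
    exact Finset.sum_congr rfl fun α _ => by ring
  have h5 : ∑ α, 2 * (gradInner g (fun z => φ z α) s x * pderiv α (Δ f) (φ x))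
      = ∑ α, 2 * (pderiv α (Δ f) (φ x) * gradInner g (fun z => φ z α) s x) :=
    Finset.sum_congr rfl fun α _ => by ring
  rw [h4, h5]
  ring

end Bilaplacian

section Square

variable {m n : ℕ} {M : Type*} [TopologicalSpace M] [ChartedSpace (EuclideanSpace ℝ (Fin m)) M]

theorem contMDiff_complex_sq {φ : M → EuclideanSpace ℝ (Fin n)}
    (hφ : ContMDiff (𝓡 m) 𝓘(ℝ, EuclideanSpace ℝ (Fin n)) ∞ φ) (α β : Fin n) :
    ContMDiff (𝓡 m) 𝓘(ℝ, ℂ) ∞ (fun x => ((φ x α : ℂ) + Complex.I * (φ x β : ℂ)) ^ 2) := by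
  have h1 := contDiff_complexCoord_pow α β 0 2 1
  simp only [one_mul, sub_zero, complexCoord_apply] at h1
  exact h1.contMDiff.comp hφ

end Square

section Morphism

variable {m n : ℕ} {M : Type*} [TopologicalSpace M]
  [ChartedSpace (EuclideanSpace ℝ (Fin m)) M] [IsManifold (𝓡 m) ∞ M]

theorem gradInner_sub_const (g : RMetric m M) {u : M → ℝ} {x : M}
    (hu : MDifferentiableAt (𝓡 m) 𝓘(ℝ, ℝ) u x) (c : ℝ) (v : M → ℝ) :
    gradInner g (fun z => u z - c) v x = gradInner g u v x := by
  rw [gradInner_eq_dmap, gradInner_eq_dmap]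
  have h := dmap_comp (f := fun r : ℝ => r - c) (by fun_prop) hu (grad g v x)
  rw [fderiv_sub_const, fderiv_fun_id] at h
  exact h

/-- If the real and imaginary parts of `(u + iv)⁴` have vanishing bilaplacian at a common zero of
`u` and `v`, then the gradients of `u` and `v` are orthogonal and of the same length there. -/
theorem conformal_of_quartic (g : RMetric m M) {u v : M → ℝ}
    (hu : ContMDiff (𝓡 m) 𝓘(ℝ, ℝ) ∞ u) (hv : ContMDiff (𝓡 m) 𝓘(ℝ, ℝ) ∞ v) {x : M}
    (hux : u x = 0) (hvx : v x = 0)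
    (hre : lap g (lap g fun z => (((u z : ℂ) + Complex.I * (v z : ℂ)) ^ 4).re) x = 0)
    (him : lap g (lap g fun z => (((u z : ℂ) + Complex.I * (v z : ℂ)) ^ 4).im) x = 0) :
    gradInner g u u x = gradInner g v v x ∧ gradInner g u v x = 0 := by
  have uu := (hu.mul_real hu)
  have vv := (hv.mul_real hv)
  have uv := (hu.mul_real hv)
  have e1 : (fun z => (((u z : ℂ) + Complex.I * (v z : ℂ)) ^ 4).re) = fun z =>
      1 * (1 * ((u z * u z) * (u z * u z)) + 1 * ((v z * v z) * (v z * v z)))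
        + (-6) * ((u z * u z) * (v z * v z)) := by
    funext z; simp [pow_succ]; ring
  have e2 : (fun z => (((u z : ℂ) + Complex.I * (v z : ℂ)) ^ 4).im) = fun z =>
      4 * ((u z * u z) * (u z * v z)) + (-4) * ((u z * v z) * (v z * v z)) := by
    funext z; simp [pow_succ]; ring
  have s1 : ContMDiff (𝓡 m) 𝓘(ℝ, ℝ) ∞ fun z =>
      1 * ((u z * u z) * (u z * u z)) + 1 * ((v z * v z) * (v z * v z)) :=
    (contMDiff_const.mul_real (uu.mul_real uu)).add_real
      (contMDiff_const.mul_real (vv.mul_real vv))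
  rw [e1, lap_lap_linear g _ _ s1 (uu.mul_real vv),
    lap_lap_linear g _ _ (uu.mul_real uu) (vv.mul_real vv),
    lap_lap_mul_four g hu hu hu hu hux hux hux hux, lap_lap_mul_four g hv hv hv hv hvx hvx hvx hvx,
    lap_lap_mul_four g hu hu hv hv hux hux hvx hvx] at hre
  rw [e2, lap_lap_linear g _ _ (uu.mul_real uv) (uv.mul_real vv),
    lap_lap_mul_four g hu hu hu hv hux hux hux hvx,
    lap_lap_mul_four g hu hv hv hv hux hvx hvx hvx] at him
  set a := gradInner g u u x
  set b := gradInner g v v x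
  set c := gradInner g u v x
  have h1 : (a - b) ^ 2 = 4 * c ^ 2 := by linarith
  have h2 : (a - b) * c = 0 := by linarith
  rcases mul_eq_zero.1 h2 with h | h
  · refine ⟨sub_eq_zero.1 h, ?_⟩
    rw [h] at h1
    exact pow_eq_zero_iff (two_ne_zero) |>.1 (by linarith)
  · refine ⟨sub_eq_zero.1 (pow_eq_zero_iff (two_ne_zero) |>.1 ?_), h⟩
    rw [h1, h]; ring

theorem GeneralizedHarmonicMorphism.lap_lap_eq_zero {g : RMetric m M}
    {φ : M → EuclideanSpace ℝ (Fin n)} (h : GeneralizedHarmonicMorphism g φ)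
    {f : EuclideanSpace ℝ (Fin n) → ℝ} (hf : ContDiff ℝ ∞ f)
    (hf' : InnerProductSpace.HarmonicOnNhd f Set.univ) (x : M) :
    lap g (lap g (f ∘ φ)) x = 0 :=
  (h Set.univ f isOpen_univ ⟨x, trivial⟩ hf.contDiffOn hf').2 x trivial

theorem GeneralizedHarmonicMorphism.horizontallyWeaklyConformal {g : RMetric m M} [NeZero n]
    {φ : M → EuclideanSpace ℝ (Fin n)} (h : GeneralizedHarmonicMorphism g φ)
    (hφ : ContMDiff (𝓡 m) 𝓘(ℝ, EuclideanSpace ℝ (Fin n)) ∞ φ) :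
    HorizontallyWeaklyConformal g φ := by
  have hφα : ∀ α, ContMDiff (𝓡 m) 𝓘(ℝ, ℝ) ∞ (fun z => φ z α) :=
    fun α z => contMDiffAt_coord (hφ z) α
  rw [horizontallyWeaklyConformal_iff g (hφ.mdifferentiable (by simp))]
  intro x
  have key : ∀ α β, α ≠ β →
      gradInner g (fun z => φ z α) (fun z => φ z α) x
        = gradInner g (fun z => φ z β) (fun z => φ z β) x ∧
      gradInner g (fun z => φ z α) (fun z => φ z β) x = 0 := by
    intro α β hαβ
    have hG : ∀ α β, gradInner g (fun z => φ z α - φ x α) (fun z => φ z β - φ x β) x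
        = gradInner g (fun z => φ z α) (fun z => φ z β) x := fun α β => by
      rw [gradInner_sub_const g ((hφα α).mdifferentiable (by simp) x), gradInner_comm,
        gradInner_sub_const g ((hφα β).mdifferentiable (by simp) x), gradInner_comm]
    have hpart : ∀ ℓ : ℂ →L[ℝ] ℝ, lap g (lap g fun z => ℓ ((((φ z α - φ x α : ℝ) : ℂ)
        + Complex.I * ((φ z β - φ x β : ℝ) : ℂ)) ^ 4)) x = 0 := by
      intro ℓ
      obtain ⟨h1, h2⟩ := harmonic_clm_complexCoord_pow hαβ (φ x) 4 ℓ Set.univ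
      have h3 := h.lap_lap_eq_zero h1 h2 x
      simpa only [Function.comp_def, complexCoord_apply, PiLp.sub_apply] using h3
    have := conformal_of_quartic g (u := fun z => φ z α - φ x α) (v := fun z => φ z β - φ x β)
      (x := x) ((hφα α).sub contMDiff_const) ((hφα β).sub contMDiff_const) (sub_self _)
      (sub_self _) (hpart Complex.reCLM) (hpart Complex.imCLM)
    simpa only [hG] using this
  refine ⟨gradInner g (fun z => φ z 0) (fun z => φ z 0) x, fun α β => ?_⟩
  split_ifs with hαβ
  · subst hαβ
    by_cases h0 : α = 0
    · rw [h0]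
    · exact (key α 0 h0).1
  · exact (key α β hαβ).2

theorem GeneralizedHarmonicMorphism.biharmonic {g : RMetric m M}
    {φ : M → EuclideanSpace ℝ (Fin n)} (h : GeneralizedHarmonicMorphism g φ)
    (hφ : ContMDiff (𝓡 m) 𝓘(ℝ, EuclideanSpace ℝ (Fin n)) ∞ φ) : Biharmonic g φ := by
  refine ⟨hφ.contMDiffOn, fun x _ => ?_⟩
  ext α
  have h1 := lap_lap_clm g (EuclideanSpace.proj (𝕜 := ℝ) α) hφ x
  exact h1.symm.trans (h.lap_lap_eq_zero (EuclideanSpace.proj (𝕜 := ℝ) α).contDiff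
    (harmonic_coord α _) x)

theorem GeneralizedHarmonicMorphism.biharmonic_complex_sq {g : RMetric m M}
    {φ : M → EuclideanSpace ℝ (Fin n)} (h : GeneralizedHarmonicMorphism g φ)
    (hφ : ContMDiff (𝓡 m) 𝓘(ℝ, EuclideanSpace ℝ (Fin n)) ∞ φ) {α β : Fin n} (hαβ : α ≠ β) :
    Biharmonic g (fun x => ((φ x α : ℂ) + Complex.I * (φ x β : ℂ)) ^ 2) := by
  have hs := contMDiff_complex_sq hφ α β
  refine ⟨hs.contMDiffOn, fun x _ => ?_⟩
  have hpart : ∀ ℓ : ℂ →L[ℝ] ℝ,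
      ℓ (lap g (lap g fun x => ((φ x α : ℂ) + Complex.I * (φ x β : ℂ)) ^ 2) x) = 0 := by
    intro ℓ
    obtain ⟨h1, h2⟩ := harmonic_clm_complexCoord_pow hαβ 0 2 ℓ Set.univ
    have h3 := h.lap_lap_eq_zero h1 h2 x
    simp only [Function.comp_def, complexCoord_apply, sub_zero] at h3
    rw [← h3, ← lap_lap_clm g ℓ hs]
  exact Complex.ext (hpart Complex.reCLM) (hpart Complex.imCLM)

/-- The second-order coefficients in the bilaplacian of a composition, for a biharmonic map the
gradients of whose components are orthogonal and of the same length. -/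
theorem second_order_coefficient (g : RMetric m M) {φ : M → EuclideanSpace ℝ (Fin n)}
    (hφ : ContMDiff (𝓡 m) 𝓘(ℝ, EuclideanSpace ℝ (Fin n)) ∞ φ) {s : M → ℝ}
    (hg : ∀ z α β, gradInner g (fun z => φ z α) (fun z => φ z β) z = if α = β then s z else 0)
    (hbi : ∀ α x, lap g (lap g fun z => φ z α) x = 0) {α β : Fin n} (hαβ : α ≠ β)
    (hsq : Biharmonic g (fun x => ((φ x α : ℂ) + Complex.I * (φ x β : ℂ)) ^ 2)) (x : M) :
    (lap g (fun z => φ z α) x ^ 2 + 2 * gradInner g (fun z => φ z α) (lap g fun z => φ z α) x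
      = lap g (fun z => φ z β) x ^ 2
        + 2 * gradInner g (fun z => φ z β) (lap g fun z => φ z β) x) ∧
    lap g (fun z => φ z α) x * lap g (fun z => φ z β) x
      + gradInner g (fun z => φ z α) (lap g fun z => φ z β) x
      + gradInner g (fun z => φ z β) (lap g fun z => φ z α) x = 0 := by
  have hφα : ∀ α, ContMDiff (𝓡 m) 𝓘(ℝ, ℝ) ∞ (fun z => φ z α) :=
    fun α z => contMDiffAt_coord (hφ z) α
  have hpart : ∀ ℓ : ℂ →L[ℝ] ℝ,
      lap g (lap g fun x => ℓ (((φ x α : ℂ) + Complex.I * (φ x β : ℂ)) ^ 2)) x = 0 := by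
    intro ℓ
    rw [lap_lap_clm g ℓ (contMDiff_complex_sq hφ α β), hsq.2 x trivial, map_zero]
  have hre := hpart Complex.reCLM
  have him := hpart Complex.imCLM
  have e1 : (fun x => Complex.reCLM (((φ x α : ℂ) + Complex.I * (φ x β : ℂ)) ^ 2)) = fun x =>
      1 * (φ x α * φ x α) + (-1) * (φ x β * φ x β) := by
    funext z; simp [pow_succ]; ring
  have e2 : (fun x => Complex.imCLM (((φ x α : ℂ) + Complex.I * (φ x β : ℂ)) ^ 2)) = fun x =>
      2 * (φ x α * φ x β) + 0 * (φ x α * φ x β) := by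
    funext z; simp [pow_succ]; ring
  have haa : ∀ α, gradInner g (fun z => φ z α) (fun z => φ z α) = s := fun α => by
    funext z; simp [hg]
  have hab : gradInner g (fun z => φ z α) (fun z => φ z β) = fun _ => 0 := by
    funext z; simp [hg, hαβ]
  rw [e1, lap_lap_linear g _ _ ((hφα α).mul_real (hφα α)) ((hφα β).mul_real (hφα β)),
    lap_lap_mul g (hφα α) (hφα α), lap_lap_mul g (hφα β) (hφα β), hbi, hbi, haa, haa] at hre
  rw [e2, lap_lap_linear g _ _ ((hφα α).mul_real (hφα β)) ((hφα α).mul_real (hφα β)),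
    lap_lap_mul g (hφα α) (hφα β), hbi, hbi, hab, lap_const] at him
  constructor <;> linarith

end Morphism

end GenHarm

end

theorem theorem2p2 {m n : ℕ} [NeZero n] {M : Type*} [TopologicalSpace M] [T2Space M]
    [SecondCountableTopology M] [ChartedSpace (EuclideanSpace ℝ (Fin m)) M]
    [IsManifold (𝓡 m) ∞ M] (g : GenHarm.RMetric m M)
    (φ : M → EuclideanSpace ℝ (Fin n))
    (hφ : ContMDiff (𝓡 m) 𝓘(ℝ, EuclideanSpace ℝ (Fin n)) ∞ φ) :
    List.TFAE [
      GenHarm.GeneralizedHarmonicMorphism g φ,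
      GenHarm.HorizontallyWeaklyConformal g φ ∧ GenHarm.Biharmonic g φ ∧
        ∀ α β : Fin n, α ≠ β →
          GenHarm.Biharmonic g
            (fun x => ((φ x α : ℂ) + Complex.I * (φ x β : ℂ)) ^ 2),
      ∃ lam : M → ℝ, (∀ x, 0 ≤ lam x) ∧
        ContMDiff (𝓡 m) 𝓘(ℝ, ℝ) ∞ (fun x => lam x ^ 2) ∧
        ∀ (U : Set (EuclideanSpace ℝ (Fin n))) (f : EuclideanSpace ℝ (Fin n) → ℝ),
          IsOpen U → ContDiffOn ℝ ∞ f U → ∀ x ∈ φ ⁻¹' U,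
            GenHarm.lap g (GenHarm.lap g (f ∘ φ)) x =
              lam x ^ 4 * (Δ (Δ f)) (φ x)
              + 2 * ∑ α : Fin n,
                  (lam x ^ 2 * GenHarm.lap g (fun z => φ z α) x
                    + GenHarm.gradInner g (fun z => lam z ^ 2) (fun z => φ z α) x)
                  * GenHarm.pderiv α (Δ f) (φ x)
              + (GenHarm.lap g (fun z => lam z ^ 2) x
                  + 2 * GenHarm.gradInner g (fun z => φ z 0)
                      (GenHarm.lap g (fun z => φ z 0)) x
                  + (GenHarm.lap g (fun z => φ z 0) x) ^ 2)
                * (Δ f) (φ x)] := by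
  open GenHarm in
  have hφα : ∀ α, ContMDiff (𝓡 m) 𝓘(ℝ, ℝ) ∞ (fun z => φ z α) :=
    fun α z => contMDiffAt_coord (hφ z) α
  tfae_have 1 → 2 := fun h =>
    ⟨h.horizontallyWeaklyConformal hφ, h.biharmonic hφ, fun _ _ hαβ =>
      h.biharmonic_complex_sq hφ hαβ⟩
  tfae_have 2 → 3 := by
    rintro ⟨hc, hb, hsq⟩
    rw [horizontallyWeaklyConformal_iff g (hφ.mdifferentiable (by simp))] at hc
    set s : M → ℝ := gradInner g (fun z => φ z 0) (fun z => φ z 0) with hsdef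
    have hs : ContMDiff (𝓡 m) 𝓘(ℝ, ℝ) ∞ s := (hφα 0).gradInner g (hφα 0)
    have hg : ∀ z α β, gradInner g (fun z => φ z α) (fun z => φ z β) z
        = if α = β then s z else 0 := by
      intro z α β
      obtain ⟨t, ht⟩ := hc z
      rw [hsdef, ht, ht, if_pos rfl]
    have hbi : ∀ α x, lap g (lap g fun z => φ z α) x = 0 := by
      intro α x
      have h1 := lap_lap_clm g (EuclideanSpace.proj (𝕜 := ℝ) α) hφ x
      rw [hb.2 x trivial, map_zero] at h1
      exact h1
    have hlam : (fun x => Real.sqrt (s x) ^ 2) = s :=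
      funext fun x => Real.sq_sqrt (gradInner_self_nonneg g _ x)
    refine ⟨fun x => Real.sqrt (s x), fun x => Real.sqrt_nonneg _, by rwa [hlam],
      fun U f hU hf x hx => ?_⟩
    have h4 : Real.sqrt (s x) ^ 4 = s x ^ 2 := by
      calc Real.sqrt (s x) ^ 4 = (Real.sqrt (s x) ^ 2) ^ 2 := by ring
        _ = s x ^ 2 := congrArg (· ^ 2) (congrFun hlam x)
    rw [hlam, h4, congrFun hlam x]
    rw [lap_lap_comp g hφ hs hg (fun α => hbi α x)
      (b := lap g (fun z => φ z 0) x ^ 2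
        + 2 * gradInner g (fun z => φ z 0) (lap g fun z => φ z 0) x) ?_ hU
      (fun p hp => hf.contDiffAt (hU.mem_nhds hp)) hx]
    · ring
    · intro α β
      split_ifs with hαβ
      · subst hαβ
        by_cases h0 : α = 0
        · subst h0; ring
        · rw [← (second_order_coefficient g hφ hg hbi h0 (hsq _ _ h0) x).1]; ring
      · exact (second_order_coefficient g hφ hg hbi hαβ (hsq _ _ hαβ) x).2
  tfae_have 3 → 1 := by
    rintro ⟨lam, -, -, h⟩ U f hU - hf hharm
    refine ⟨hf.contMDiffOn.comp hφ.contMDiffOn (fun _ hx => hx), fun x hx => ?_⟩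
    have h0 : Δ f =ᶠ[nhds (φ x)] fun _ => 0 := (hharm _ hx).2
    have h1 : (Δ (Δ f)) (φ x) = 0 := by
      rw [(InnerProductSpace.laplacian_congr_nhds h0).self_of_nhds]
      simp
    have h2 : ∀ α, pderiv α (Δ f) (φ x) = 0 := fun α => by
      rw [(pderiv_congr h0 α).self_of_nhds]
      simp [pderiv]
    rw [h U f hU hf x hx, h1, h0.self_of_nhds]
    simp [h2]
  tfae_finish
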